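/- Let $\ell$ be a prime, let $V$ be a $\mathbb{Q}_\ell$-vector space of finite positive dimension $d$, and let $T\subset V$ be a $\mathbb{Z}_\ell$-lattice of rank $d$. For $u\in \mathrm{End}_{\mathbb{Q}_\ell}(V)$ let $P_u(t)=\det(t\cdot 1-u\mid V)$ be its characteristic polynomial, let $\Delta(u)\in\mathbb{Q}_\ell$ be the discriminant of $P_u$, and let $$Z(u)_0=\{f\in \mathrm{End}_{\mathbb{Q}_\ell}(V): fu=uf,\ f(T)\subset T\},$$ which is a $\mathbb{Z}_\ell$-subalgebra of $\mathrm{End}_{\mathbb{Q}_\ell}(V)$. Let $\mathbb{G}\subset \mathrm{GL}(V)$ be a connected reductive linear algebraic subgroup over $\mathbb{Q}_\ell$, and give $\mathbb{G}(\mathbb{Q}_\ell)\subset\mathrm{Aut}_{\mathbb{Q}_\ell}(V)$ the $\ell$-adic topology. Let $G$ be an open compact subgroup of $\mathbb{G}(\mathbb{Q}_\ell)$ that lies in $\mathrm{Aut}_{\mathbb{Z}_\ell}(T)$, i.e. $g(T)=T$ for all $g\in G$. Let $\bar u\in\mathbb{G}(\mathbb{Q}_\ell)$ be an element whose characteristic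 polynomial $P_{\bar u}(t)$ has no multiple roots in an algebraic closure of $\mathbb{Q}_\ell$. Let $X(\bar u,T,G)$ be the set of all $u\in G$ such that the $\mathbb{Z}_\ell$-algebras $Z(u)_0$ and $Z(\bar u)_0$ are isomorphic. Then $X(\bar u,T,G)$ is a nonempty open subset of $G$ that is stable under conjugation by elements of $G$. Its boundary in $G$ lies in $G_\Delta=\{u\in G:\Delta(u)=0\}$ and, if $d\ge 2$, contains the identity element. -/

import Mathlib

open scoped TensorProduct Topology

noncomputable section

section AlgebraicGroups

variable (k : Type*) [Field k] (V : Type*) [AddCommGroup V] [Module k V]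

/-- The group of points of the algebraic group `GL(V)` over the algebraic closure of `k`. -/
abbrev GeomGL : Type _ :=
  LinearMap.GeneralLinearGroup (AlgebraicClosure k) (AlgebraicClosure k ⊗[k] V)

variable {k V}

/-- The matrix coefficients `⟨φ, g v⟩` of a geometric point `g` of `GL(V)`, indexed by the
pairs `(φ, v)` with `φ ∈ V^*` and `v ∈ V`. (For a basis `e i` of `V`, the pairs of the form
`(e i ^*, e j)` give the usual matrix entries, and the others are `k`-linear in these.) -/
def matrixCoeff (g : GeomGL k V) (x : Module.Dual k V × V) : AlgebraicClosure k :=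
  Module.Dual.baseChange (AlgebraicClosure k) x.1
    ((g : Module.End (AlgebraicClosure k) (AlgebraicClosure k ⊗[k] V)) (1 ⊗ₜ[k] x.2))

variable (k V) in
/-- The Zariski topology on the geometric points of `GL(V)`, for `V` finite-dimensional: the sets `{g | p(g) ≠ 0}`, for `p` a
polynomial in the matrix coefficients over the algebraic closure, are a basis of open sets. -/
@[reducible]
def zariskiTopologyGL : TopologicalSpace (GeomGL k V) :=
  TopologicalSpace.generateFrom
    {U | ∃ p : MvPolynomial (Module.Dual k V × V) (AlgebraicClosure k),
      U = {g | MvPolynomial.aeval (matrixCoeff g) p ≠ 0}}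

/-- The base change map from `GL(V)(k)` to the geometric points of `GL(V)`. -/
def geomPoint : LinearMap.GeneralLinearGroup k V →* GeomGL k V :=
  Units.map
    (Module.End.baseChangeHom k (AlgebraicClosure k) V :
      Module.End k V →* Module.End (AlgebraicClosure k) (AlgebraicClosure k ⊗[k] V))

variable (k V) in
/-- A linear algebraic subgroup `𝔾 ⊆ GL(V)`, for `V` a finite-dimensional vector space over a
field `k` of characteristic zero, given by its
group of geometric points: a subgroup that is cut out in `GL(V)` by polynomial equations with
coefficients in `k`. (In characteristic zero every closed subgroup scheme is reduced, so that it is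
determined by these points.) -/
structure LinearAlgebraicSubgroup [CharZero k] where
  geomPoints : Subgroup (GeomGL k V)
  exists_equations : ∃ S : Set (MvPolynomial (Module.Dual k V × V) k),
    (geomPoints : Set (GeomGL k V)) = {g | ∀ p ∈ S, MvPolynomial.aeval (matrixCoeff g) p = 0}

namespace LinearAlgebraicSubgroup

variable [CharZero k]

/-- The group `𝔾(k)` of `k`-rational points. -/
def rationalPoints (GG : LinearAlgebraicSubgroup k V) :
    Subgroup (LinearMap.GeneralLinearGroup k V) :=
  GG.geomPoints.comap geomPoint

/-- `𝔾` is connected (equivalently, geometrically connected). -/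
def IsConnectedGroup (GG : LinearAlgebraicSubgroup k V) : Prop :=
  @IsConnected (GeomGL k V) (zariskiTopologyGL k V) (GG.geomPoints : Set (GeomGL k V))

/-- The unipotent radical of `𝔾` over the algebraic closure is trivial: every Zariski-closed
connected normal subgroup of `𝔾` that consists of unipotent elements is trivial. -/
def IsReductive (GG : LinearAlgebraicSubgroup k V) : Prop :=
  ∀ U : Subgroup (GeomGL k V), U ≤ GG.geomPoints →
    (∀ g ∈ GG.geomPoints, ∀ u ∈ U, g * u * g⁻¹ ∈ U) →
    IsClosed[zariskiTopologyGL k V] (U : Set (GeomGL k V)) →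
    @IsConnected (GeomGL k V) (zariskiTopologyGL k V) (U : Set (GeomGL k V)) →
    (∀ u ∈ U, IsNilpotent
      ((u : Module.End (AlgebraicClosure k) (AlgebraicClosure k ⊗[k] V)) - 1)) →
    U = ⊥

end LinearAlgebraicSubgroup

end AlgebraicGroups

section Padic

variable {ℓ : ℕ} [Fact ℓ.Prime] {V : Type*} [AddCommGroup V] [Module ℚ_[ℓ] V]

/-- The `ℓ`-adic topology on `End(V)`, for `V` a finite-dimensional `ℚ_ℓ`-vector space: its
topology as a finite-dimensional `ℚ_ℓ`-vector space. Through it, `Aut(V)` gets its `ℓ`-adic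
topology (the topology of the group of units), and so do the subgroups of `Aut(V)`. -/
instance ladicTopologyEnd : TopologicalSpace (Module.End ℚ_[ℓ] V) :=
  moduleTopology ℚ_[ℓ] (Module.End ℚ_[ℓ] V)

variable [Module ℤ_[ℓ] V] [IsScalarTower ℤ_[ℓ] ℚ_[ℓ] V]

/-- The `ℤ_ℓ`-subalgebra `End_{ℤ_ℓ}(T)` of `End_{ℚ_ℓ}(V)`, for `T` a lattice in `V`. -/
def endLattice (T : Submodule ℤ_[ℓ] V) : Subalgebra ℤ_[ℓ] (Module.End ℚ_[ℓ] V) where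
  carrier := {f | ∀ x ∈ T, f x ∈ T}
  mul_mem' := fun hf hg x hx => hf _ (hg x hx)
  add_mem' := fun hf hg x hx => T.add_mem (hf x hx) (hg x hx)
  algebraMap_mem' := fun r _ hx => T.smul_mem r hx

/-- The order `Z(u)_0`: the intersection of the centralizer of `u` in `End_{ℚ_ℓ}(V)` with
`End_{ℤ_ℓ}(T)`. -/
def centralizerOrder (T : Submodule ℤ_[ℓ] V) (u : Module.End ℚ_[ℓ] V) :
    Subalgebra ℤ_[ℓ] (Module.End ℚ_[ℓ] V) :=
  Subalgebra.centralizer ℤ_[ℓ] {u} ⊓ endLattice T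

/-- The set `X(ū, T, G)` of all `u ∈ G` such that `Z(u)_0` is isomorphic to `Z(ū)_0` as a
`ℤ_ℓ`-algebra, for `G` a subgroup of a subgroup `H` of `Aut(V)`, and `ū ∈ H`. -/
def orderLocus (T : Submodule ℤ_[ℓ] V) {H : Subgroup (LinearMap.GeneralLinearGroup ℚ_[ℓ] V)}
    (G : Subgroup H) (ub : H) : Set G :=
  {u | Nonempty (centralizerOrder T ((u : H) : LinearMap.GeneralLinearGroup ℚ_[ℓ] V).val ≃ₐ[ℤ_[ℓ]]
    centralizerOrder T (ub : LinearMap.GeneralLinearGroup ℚ_[ℓ] V).val)}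

/-- `Δ(u)`, the discriminant of the characteristic polynomial of `u`. -/
def charDiscr [FiniteDimensional ℚ_[ℓ] V] (u : Module.End ℚ_[ℓ] V) : ℚ_[ℓ] :=
  (LinearMap.charpoly u).discr

end Padic

end

/-! Write `Z(u)` for the centralizer of `u` in `End(V)`. If `u` has simple spectrum, then `ad u` is
semisimple, so `End(V)` is the direct sum of `Z(u)` and the image of `ad u`. Hence `(g, t) ↦ g t
g⁻¹`, with `t ∈ Z(u)`, is a submersion at `(1, u)`: every `v` near `u` is `g t g⁻¹` with `g` in
`Aut(T)` and `t` so close to `u` that `Z(t) = Z(u)`. Then `Z(v)_0 = g Z(u)_0 g⁻¹`, and the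
isomorphism class of the order is locally constant at `u`
(`IsLatticeBasis.eventually_nonempty_equiv`). Simplicity of the spectrum can be read off from the
`ℤ_ℓ`-algebra (`IsLatticeBasis.hasSimpleSpectrum_of_equiv`), so `X` is open. At a point with `Δ ≠ 0`
the class is locally constant, so such a point is not on the boundary. For `d ≥ 2` the identity is
not in `X`, because `End(T)` is not commutative while `Z(ū)_0` is.

It remains to see that 1 lies in the closure of `X`, which also makes `X` nonempty. It suffices to
find rational points `g` arbitrarily near 1 with `Z(g) = Z(ū)`
(`LinearAlgebraicSubgroup.exists_mem_nhds_centralizer_eq`). They come from an element `c` of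
`Lie(𝔾)` commuting with `ū` and having distinct eigenvalues: take `g = exp(tc)` for small `t ≠ 0`.

The existence of `c` is the heart (`MatPoly.exists_diagCoord_ne`). Suppose that two eigenlines of
`ū`, with eigenvalues `μ_i ≠ μ_j`, carry the same weight on the centralizer of `ū` in `Lie(𝔾)`. Put
`r = μ_j / μ_i` and `F(g) = ∏ (r λ_a - λ_b)` over pairs of eigenvalues of `g`. Moving from `ū` along
its centralizer keeps the ratio `r`, so `F` is flat at `ū` in these directions. The other directions
of `Lie(𝔾)` are tangent to conjugacy classes, where `F` is constant, so all derivatives of `F` along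
`𝔾` vanish at `ū`. In characteristic zero a function on a connected group with zero jet at a point
is zero (`MatPoly.jetIdeal_eq`). But `F(1)` is a power of `r - 1 ≠ 0`. Galois descent, and the fact
that a vector space over an infinite field is not a finite union of proper subspaces, then give one
rational `c` separating all weights. -/

noncomputable section

/-! ### Polynomial functions on matrices and invariant vector fields -/

namespace MatPoly

open MvPolynomial

variable {n : Type*} [Fintype n] {K : Type*} [Field K]

/-- Evaluation of a polynomial in the matrix entries at a matrix. -/
def ev {A : Type*} [CommRing A] [Algebra K A] (g : Matrix n n A) :
    MvPolynomial (n × n) K →ₐ[K] A :=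
  aeval fun ij => g ij.1 ij.2

omit [Fintype n] in
@[simp] lemma ev_X {A : Type*} [CommRing A] [Algebra K A] (g : Matrix n n A) (ij : n × n) :
    ev (K := K) g (X ij) = g ij.1 ij.2 := by
  simp [ev]

/-- The derivation of the ring of polynomial functions on matrices that comes from the vector
field `g ↦ g * x`. -/
def rightDer (x : Matrix n n K) :
    Derivation K (MvPolynomial (n × n) K) (MvPolynomial (n × n) K) :=
  mkDerivation K fun ij => ∑ k, X (ij.1, k) * C (x k ij.2)

/-- The derivation of the ring of polynomial functions on matrices that comes from the vector
field `g ↦ x * g`. -/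
def leftDer (x : Matrix n n K) :
    Derivation K (MvPolynomial (n × n) K) (MvPolynomial (n × n) K) :=
  mkDerivation K fun ij => ∑ k, C (x ij.1 k) * X (k, ij.2)

/-- Composition of polynomial functions with left translation by `h`. -/
def leftTranslate (h : Matrix n n K) : MvPolynomial (n × n) K →ₐ[K] MvPolynomial (n × n) K :=
  aeval fun ij => ∑ k, C (h ij.1 k) * X (k, ij.2)

lemma rightDer_X (x : Matrix n n K) (ij : n × n) :
    rightDer x (X ij) = ∑ k, X (ij.1, k) * C (x k ij.2) := by
  simp [rightDer, mkDerivation_X]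

lemma leftDer_X (x : Matrix n n K) (ij : n × n) :
    leftDer x (X ij) = ∑ k, C (x ij.1 k) * X (k, ij.2) := by
  simp [leftDer, mkDerivation_X]

lemma leftTranslate_X (x : Matrix n n K) (ij : n × n) :
    leftTranslate x (X ij) = ∑ k, C (x ij.1 k) * X (k, ij.2) := by
  simp [leftTranslate]

lemma ev_leftTranslate (h g : Matrix n n K) (p : MvPolynomial (n × n) K) :
    ev g (leftTranslate h p) = ev (h * g) p := by
  have : (ev g).comp (leftTranslate h) = ev (K := K) (h * g) := by
    ext ij
    simp [leftTranslate_X, Matrix.mul_apply, ev]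
  exact congrArg (fun f => f p) this

lemma ev_rightDer_X (x g : Matrix n n K) (ij : n × n) :
    ev g (rightDer x (X ij)) = (g * x) ij.1 ij.2 := by
  simp [rightDer_X, Matrix.mul_apply, ev]

lemma ev_leftDer_X (x g : Matrix n n K) (ij : n × n) :
    ev g (leftDer x (X ij)) = (x * g) ij.1 ij.2 := by
  simp [leftDer_X, Matrix.mul_apply, ev]

/-- The vector field `g ↦ g * x` is left invariant. -/
lemma rightDer_leftTranslate (x h : Matrix n n K) (p : MvPolynomial (n × n) K) :
    rightDer x (leftTranslate h p) = leftTranslate h (rightDer x p) := by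
  induction p using MvPolynomial.induction_on with
  | C a => simp [← MvPolynomial.algebraMap_eq]
  | add p q hp hq => simp [hp, hq]
  | mul_X p ij hp =>
    have : rightDer x (leftTranslate h (X ij)) = leftTranslate h (rightDer x (X ij)) := by
      simp only [leftTranslate_X, rightDer_X, map_sum, Derivation.leibniz, map_mul,
        Finset.sum_mul, Finset.mul_sum, smul_eq_mul]
      rw [Finset.sum_comm]
      simp [← MvPolynomial.algebraMap_eq, mul_assoc]
    simp only [map_mul, Derivation.leibniz, hp, this, smul_eq_mul, map_add]

lemma rightDer_add (x y : Matrix n n K) : rightDer (x + y) = rightDer x + rightDer y := by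
  ext ij : 1
  simp [rightDer_X, mul_add, Finset.sum_add_distrib]

lemma rightDer_smul (c : K) (x : Matrix n n K) : rightDer (c • x) = c • rightDer x := by
  ext ij : 1
  simp [rightDer_X, MvPolynomial.smul_eq_C_mul, Finset.mul_sum, mul_left_comm]

lemma rightDer_sub (x y : Matrix n n K) : rightDer (x - y) = rightDer x - rightDer y := by
  rw [eq_sub_iff_add_eq, ← rightDer_add, sub_add_cancel]

lemma rightDer_rightDer_X (x y : Matrix n n K) (ij : n × n) :
    rightDer x (rightDer y (X ij)) = rightDer (x * y) (X ij) := by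
  have h : ∀ k, rightDer x (X (ij.1, k) * C (y k ij.2)) =
      ∑ l, X (ij.1, l) * C (x l k * y k ij.2) := fun k => by
    rw [mul_comm, ← MvPolynomial.smul_eq_C_mul, Derivation.map_smul, rightDer_X,
      MvPolynomial.smul_eq_C_mul, Finset.mul_sum]
    exact Finset.sum_congr rfl fun l _ => by rw [C_mul]; ring
  rw [rightDer_X y, map_sum, Finset.sum_congr rfl fun k _ => h k, Finset.sum_comm, rightDer_X]
  exact Finset.sum_congr rfl fun l _ => by rw [Matrix.mul_apply, map_sum, Finset.mul_sum]

lemma rightDer_comm (x y : Matrix n n K) (p : MvPolynomial (n × n) K) :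
    rightDer x (rightDer y p) - rightDer y (rightDer x p) = rightDer (x * y - y * x) p := by
  have h : ⁅rightDer x, rightDer y⁆ = rightDer (x * y - y * x) := by
    refine MvPolynomial.derivation_ext fun ij => ?_
    rw [Derivation.commutator_apply, rightDer_rightDer_X, rightDer_rightDer_X, rightDer_sub]
    rfl
  rw [← h, Derivation.commutator_apply]

lemma leftDer_rightDer (x y : Matrix n n K) (p : MvPolynomial (n × n) K) :
    leftDer x (rightDer y p) = rightDer y (leftDer x p) := by
  have h : ⁅leftDer x, rightDer y⁆ = 0 := by
    refine MvPolynomial.derivation_ext fun ij => ?_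
    have h1 : ∀ k, leftDer x (X (ij.1, k) * C (y k ij.2)) =
        ∑ l, C (x ij.1 l) * X (l, k) * C (y k ij.2) := fun k => by
      rw [mul_comm, ← MvPolynomial.smul_eq_C_mul, Derivation.map_smul, leftDer_X,
        MvPolynomial.smul_eq_C_mul, Finset.mul_sum]
      exact Finset.sum_congr rfl fun l _ => by ring
    have h2 : ∀ k, rightDer y (C (x ij.1 k) * X (k, ij.2)) =
        ∑ l, C (x ij.1 k) * X (k, l) * C (y l ij.2) := fun k => by
      rw [← MvPolynomial.smul_eq_C_mul, Derivation.map_smul, rightDer_X,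
        MvPolynomial.smul_eq_C_mul, Finset.mul_sum]
      exact Finset.sum_congr rfl fun l _ => by ring
    rw [Derivation.commutator_apply, rightDer_X, leftDer_X, map_sum, map_sum,
      Finset.sum_congr rfl fun k _ => h1 k, Finset.sum_congr rfl fun k _ => h2 k,
      Finset.sum_comm, sub_self, Derivation.zero_apply]
  rw [← sub_eq_zero, ← Derivation.commutator_apply, h, Derivation.zero_apply]

omit [Fintype n] in
/-- The value of a derivation at the point `g` is the derivative along a line through `g`. -/
lemma ev_derivation_eq (D : Derivation K (MvPolynomial (n × n) K) (MvPolynomial (n × n) K))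
    (g y : Matrix n n K) (h : ∀ ij, ev g (D (X ij)) = y ij.1 ij.2) (p : MvPolynomial (n × n) K) :
    ev g (D p) = (Polynomial.derivative
      (ev (g.map Polynomial.C + Polynomial.X (R := K) • y.map Polynomial.C) p)).eval 0 := by
  have h0 : ∀ q : MvPolynomial (n × n) K, (ev (g.map Polynomial.C +
      Polynomial.X (R := K) • y.map Polynomial.C) q).eval 0 = ev g q := by
    intro q
    have : (Polynomial.aeval (0 : K)).comp ((ev (g.map Polynomial.C +
      Polynomial.X (R := K) • y.map Polynomial.C))) = ev (K := K) g := by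
      ext ij
      simp
    rw [← this, AlgHom.comp_apply, Polynomial.coe_aeval_eq_eval]
  induction p using MvPolynomial.induction_on with
  | C a => simp [← MvPolynomial.algebraMap_eq]
  | add p q hp hq => simp [hp, hq]
  | mul_X p ij hp => simp [hp, h, h0]; ring

omit [Fintype n] in
lemma eval_ev_line (g y : Matrix n n K) (s : K) (p : MvPolynomial (n × n) K) :
    (ev (g.map Polynomial.C + Polynomial.X (R := K) • y.map Polynomial.C) p).eval s =
      ev (g + s • y) p := by
  have : (Polynomial.aeval (s : K)).comp ((ev (g.map Polynomial.C +
    Polynomial.X (R := K) • y.map Polynomial.C))) = ev (K := K) (g + s • y) := by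
    ext ij
    simp
    exact mul_comm _ _
  rw [← this, AlgHom.comp_apply, Polynomial.coe_aeval_eq_eval]

/-- If a polynomial vanishes at all points of the line `s ↦ g + s • g * x`, then its derivative
along `x` at `g` is zero. -/
lemma ev_rightDer_eq_zero_of_line [Infinite K] (g x : Matrix n n K) (p : MvPolynomial (n × n) K)
    (h : ∀ s : K, ev (g + s • (g * x)) p = 0) : ev g (rightDer x p) = 0 := by
  rw [ev_derivation_eq _ g (g * x) (ev_rightDer_X x g)]
  have : ev (g.map Polynomial.C + Polynomial.X (R := K) • (g * x).map Polynomial.C) p = 0 :=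
    Polynomial.funext fun s => by rw [eval_ev_line, h, Polynomial.eval_zero]
  rw [this, Polynomial.derivative_zero, Polynomial.eval_zero]

/-- The two vector fields agree at `g` because `x g = g (g⁻¹ x g)`. -/
lemma ev_rightDer_conj [DecidableEq n] (g : (Matrix n n K)ˣ) (x : Matrix n n K)
    (p : MvPolynomial (n × n) K) :
    ev (g : Matrix n n K) (leftDer x p) =
      ev (g : Matrix n n K) (rightDer (((g⁻¹ : (Matrix n n K)ˣ) : Matrix n n K) * x * (g : Matrix n n K)) p) := by
  rw [ev_derivation_eq _ (g : Matrix n n K) (x * g) (ev_leftDer_X x _),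
    ev_derivation_eq _ (g : Matrix n n K) (x * g)]
  intro ij
  rw [ev_rightDer_X, ← mul_assoc, ← mul_assoc, Units.mul_inv, one_mul]

/-- The iterated derivative of `p` along a list of matrices. -/
def wordDer (l : List (Matrix n n K)) (p : MvPolynomial (n × n) K) : MvPolynomial (n × n) K :=
  l.foldr (fun x q => rightDer x q) p

@[simp] lemma wordDer_nil (p : MvPolynomial (n × n) K) : wordDer [] p = p := rfl

@[simp] lemma wordDer_cons (x : Matrix n n K) (l : List (Matrix n n K))
    (p : MvPolynomial (n × n) K) : wordDer (x :: l) p = rightDer x (wordDer l p) := rfl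

lemma wordDer_append (l m : List (Matrix n n K)) (p : MvPolynomial (n × n) K) :
    wordDer (l ++ m) p = wordDer l (wordDer m p) := by
  simp [wordDer]

lemma wordDer_add (l : List (Matrix n n K)) (p q : MvPolynomial (n × n) K) :
    wordDer l (p + q) = wordDer l p + wordDer l q := by
  induction l with
  | nil => rfl
  | cons x l ih => simp [ih]

lemma wordDer_sub (l : List (Matrix n n K)) (p q : MvPolynomial (n × n) K) :
    wordDer l (p - q) = wordDer l p - wordDer l q := by
  induction l with
  | nil => rfl
  | cons x l ih => simp [ih]

lemma wordDer_zero (l : List (Matrix n n K)) :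
    wordDer l (0 : MvPolynomial (n × n) K) = 0 := by
  induction l with
  | nil => rfl
  | cons x l ih => simp [ih]

lemma wordDer_leftTranslate (l : List (Matrix n n K)) (h : Matrix n n K)
    (p : MvPolynomial (n × n) K) :
    wordDer l (leftTranslate h p) = leftTranslate h (wordDer l p) := by
  induction l with
  | nil => rfl
  | cons x l ih => simp [ih, rightDer_leftTranslate]

lemma wordDer_leftDer (l : List (Matrix n n K)) (x : Matrix n n K) (p : MvPolynomial (n × n) K) :
    wordDer l (leftDer x p) = leftDer x (wordDer l p) := by
  induction l with
  | nil => rfl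
  | cons y l ih => simp [ih, leftDer_rightDer]

end MatPoly

/-! ### The tangent space at the identity, and jets of functions on a connected group -/

namespace MatPoly

open MvPolynomial

variable {n : Type*} [Fintype n] [DecidableEq n] {K : Type*} [Field K]

/-- The ideal of the polynomials that vanish on a set of matrices. -/
def vanishingIdeal (Γ : Set (Matrix n n K)) : Ideal (MvPolynomial (n × n) K) where
  carrier := {p | ∀ g ∈ Γ, ev g p = 0}
  zero_mem' := fun g _ => map_zero _
  add_mem' := fun hp hq g hg => by rw [map_add, hp g hg, hq g hg, add_zero]
  smul_mem' := fun c p hp g hg => by rw [smul_eq_mul, map_mul, hp g hg, mul_zero]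

/-- The differential of a polynomial function at the identity matrix. -/
def diffOne : MvPolynomial (n × n) K →ₗ[K] Matrix n n K →ₗ[K] K :=
  LinearMap.mk₂ K (fun p x => ev 1 (rightDer x p))
    (fun p q x => by simp) (fun c p x => by simp)
    (fun p x y => by simp [rightDer_add]) (fun c p x => by simp [rightDer_smul])

lemma diffOne_apply (p : MvPolynomial (n × n) K) (x : Matrix n n K) :
    diffOne p x = ev 1 (rightDer x p) := rfl

lemma diffOne_mul (p q : MvPolynomial (n × n) K) (x : Matrix n n K) :
    diffOne (p * q) x = ev 1 p * diffOne q x + ev 1 q * diffOne p x := by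
  simp [diffOne_apply, Derivation.leibniz]

lemma diffOne_X (ij : n × n) (x : Matrix n n K) : diffOne (X ij) x = x ij.1 ij.2 := by
  rw [diffOne_apply, ev_rightDer_X, one_mul]

lemma diffOne_C (c : K) (x : Matrix n n K) : diffOne (C c) x = 0 := by
  simp [diffOne_apply, ← MvPolynomial.algebraMap_eq]

/-- The tangent space at the identity of the Zariski closure of a set of matrices. -/
def tangent (Γ : Set (Matrix n n K)) : Submodule K (Matrix n n K) where
  carrier := {x | ∀ p ∈ vanishingIdeal Γ, diffOne p x = 0}
  zero_mem' := fun p _ => map_zero _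
  add_mem' := fun hx hy p hp => by rw [map_add, hx p hp, hy p hp, add_zero]
  smul_mem' := fun c x hx p hp => by rw [map_smul, hx p hp, smul_zero]

/-- The ideal of the polynomials that vanish at the identity matrix. -/
def maxOne (n K : Type*) [Fintype n] [DecidableEq n] [Field K] :
    Ideal (MvPolynomial (n × n) K) :=
  RingHom.ker (ev (1 : Matrix n n K)).toRingHom

lemma mem_maxOne {p : MvPolynomial (n × n) K} : p ∈ maxOne n K ↔ ev (1 : Matrix n n K) p = 0 :=
  Iff.rfl

/-- The linear function, vanishing at the identity matrix, with the given differential. -/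
def linearPoly (φ : Matrix n n K →ₗ[K] K) : MvPolynomial (n × n) K :=
  ∑ ij : n × n, C (φ (Matrix.single ij.1 ij.2 1)) * (X ij - C ((1 : Matrix n n K) ij.1 ij.2))

lemma linearPoly_mem (φ : Matrix n n K →ₗ[K] K) : linearPoly φ ∈ maxOne n K := by
  simp [mem_maxOne, linearPoly, ← MvPolynomial.algebraMap_eq]

lemma diffOne_linearPoly (φ : Matrix n n K →ₗ[K] K) : diffOne (linearPoly φ) = φ := by
  ext x : 1
  have hx : x = ∑ ij : n × n, x ij.1 ij.2 • Matrix.single ij.1 ij.2 (1 : K) := by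
    conv_lhs => rw [Matrix.matrix_eq_sum_single x]
    rw [Fintype.sum_prod_type]
    simp
  conv_rhs => rw [hx]
  simp only [linearPoly, map_sum, LinearMap.sum_apply, diffOne_mul, map_sub, LinearMap.sub_apply,
    diffOne_X, diffOne_C, map_smul, smul_eq_mul, ev_X, mul_zero, sub_zero, add_zero]
  refine Finset.sum_congr rfl fun ij _ => ?_
  simp [← MvPolynomial.algebraMap_eq, mul_comm]

lemma linearPoly_add (φ ψ : Matrix n n K →ₗ[K] K) :
    linearPoly (φ + ψ) = linearPoly φ + linearPoly ψ := by
  simp [linearPoly, add_mul, Finset.sum_add_distrib]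

lemma linearPoly_zero : linearPoly (0 : Matrix n n K →ₗ[K] K) = 0 := by
  simp [linearPoly]

lemma linearPoly_smul (c : K) (φ : Matrix n n K →ₗ[K] K) :
    linearPoly (c • φ) = C c * linearPoly φ := by
  simp [linearPoly, Finset.mul_sum, mul_assoc]

lemma linearPoly_diffOne_X (ij : n × n) :
    linearPoly (diffOne (X ij)) = X ij - C ((1 : Matrix n n K) ij.1 ij.2) := by
  rw [linearPoly, Finset.sum_eq_single ij]
  · simp [diffOne_X]
  · rintro ⟨i, j⟩ _ h
    rw [diffOne_X, Matrix.single_apply, if_neg, C_0, zero_mul]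
    rintro ⟨rfl, rfl⟩
    exact h rfl
  · simp

/-- First order Taylor expansion at the identity matrix. -/
lemma taylor_one (p : MvPolynomial (n × n) K) :
    p - C (ev 1 p) - linearPoly (diffOne p) ∈ maxOne n K ^ 2 := by
  induction p using MvPolynomial.induction_on with
  | C a =>
    have : diffOne (C a : MvPolynomial (n × n) K) = 0 := LinearMap.ext fun x => diffOne_C a x
    rw [this]
    simp [linearPoly_zero, ← MvPolynomial.algebraMap_eq]
  | add p q hp hq =>
    rw [map_add, map_add, map_add, linearPoly_add]
    convert add_mem hp hq using 1
    ring
  | mul_X p ij hp =>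
    set q : MvPolynomial (n × n) K := X ij with hq
    have hd : diffOne (p * q) =
        ev (1 : Matrix n n K) p • diffOne q + ev (1 : Matrix n n K) q • diffOne p :=
      LinearMap.ext fun x => diffOne_mul p q x
    have hq2 : q - C (ev 1 q) - linearPoly (diffOne q) = 0 := by
      rw [hq, linearPoly_diffOne_X, ev_X, sub_self]
    have h3 : linearPoly (diffOne p) * linearPoly (diffOne q) ∈ maxOne n K ^ 2 := by
      rw [pow_two]
      exact Ideal.mul_mem_mul (linearPoly_mem _) (linearPoly_mem _)
    rw [hd, linearPoly_add, linearPoly_smul, linearPoly_smul, map_mul, C_mul]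
    convert add_mem (Ideal.mul_mem_right q _ hp) h3 using 1
    linear_combination (C (ev 1 p) + linearPoly (diffOne p)) * hq2

variable {Γ : Set (Matrix n n K)}

/-- A polynomial that vanishes at the identity, and whose differential vanishes on the tangent
space, is of second order modulo the vanishing ideal. -/
lemma mem_sup_sq {p : MvPolynomial (n × n) K} (hp : p ∈ maxOne n K)
    (hone : (1 : Matrix n n K) ∈ Γ)
    (hd : ∀ x ∈ tangent Γ, diffOne p x = 0) : p ∈ vanishingIdeal Γ ⊔ maxOne n K ^ 2 := by
  set L : Submodule K (Module.Dual K (Matrix n n K)) :=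
    ((vanishingIdeal Γ).restrictScalars K).map diffOne with hL
  -- The tangent space is the common kernel of `L`, and in finite dimension a functional that
  -- vanishes on the common kernel of a space of functionals belongs to it.
  have h1 : diffOne p ∈ L.dualCoannihilator.dualAnnihilator := by
    rw [Submodule.mem_dualAnnihilator]
    intro x hx
    refine hd x fun q hq => ?_
    rw [Submodule.mem_dualCoannihilator] at hx
    exact hx _ (Submodule.mem_map_of_mem hq)
  rw [Subspace.dualCoannihilator_dualAnnihilator_eq] at h1
  obtain ⟨q, hq, hqp⟩ := h1
  have hq1 : ev (1 : Matrix n n K) q = 0 := hq 1 hone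
  have h2 := taylor_one (p - q)
  rw [map_sub, map_sub, map_sub, hqp, sub_self, mem_maxOne.1 hp, hq1, linearPoly_zero, C_0, sub_zero,
    sub_zero, sub_zero] at h2
  rw [← sub_add_cancel p q, add_comm]
  refine Submodule.add_mem_sup hq ?_
  exact h2

/-- The Zariski-connected subgroups of the general linear group, as sets of matrices.
Connectedness is expressed through basic open sets. -/
structure IsConnectedGroup (Γ : Set (Matrix n n K)) : Prop where
  one_mem : 1 ∈ Γ
  mul_mem : ∀ g ∈ Γ, ∀ h ∈ Γ, g * h ∈ Γ
  exists_inv : ∀ g ∈ Γ, ∃ h ∈ Γ, g * h = 1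
  connected : ∀ A B : Set (MvPolynomial (n × n) K),
    (∀ g ∈ Γ, (∃ p ∈ A, ev g p ≠ 0) ∨ ∃ p ∈ B, ev g p ≠ 0) →
    (∃ g ∈ Γ, ∃ p ∈ A, ev g p ≠ 0) → (∃ g ∈ Γ, ∃ p ∈ B, ev g p ≠ 0) →
    ∃ g ∈ Γ, (∃ p ∈ A, ev g p ≠ 0) ∧ ∃ p ∈ B, ev g p ≠ 0

/-- By left invariance the derivative of `p` at `g ∈ Γ` is the derivative at 1 of the translate of
`p` by `g`, which again vanishes on `Γ`. -/
lemma rightDer_mem_vanishingIdeal (hΓ : IsConnectedGroup Γ) {x : Matrix n n K}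
    (hx : x ∈ tangent Γ) {p : MvPolynomial (n × n) K} (hp : p ∈ vanishingIdeal Γ) :
    rightDer x p ∈ vanishingIdeal Γ := by
  intro g hg
  have h : leftTranslate g p ∈ vanishingIdeal Γ := fun h hh => by
    rw [ev_leftTranslate]
    exact hp _ (hΓ.mul_mem g hg h hh)
  have := hx _ h
  rwa [diffOne_apply, rightDer_leftTranslate, ev_leftTranslate, mul_one] at this

lemma commutator_mem_tangent (hΓ : IsConnectedGroup Γ) {x y : Matrix n n K}
    (hx : x ∈ tangent Γ) (hy : y ∈ tangent Γ) : x * y - y * x ∈ tangent Γ := by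
  intro p hp
  rw [diffOne_apply, ← rightDer_comm, map_sub]
  have h1 := hx _ (rightDer_mem_vanishingIdeal hΓ hy hp)
  have h2 := hy _ (rightDer_mem_vanishingIdeal hΓ hx hp)
  rw [diffOne_apply] at h1 h2
  rw [h1, h2, sub_zero]

lemma wordDer_mem_vanishingIdeal (hΓ : IsConnectedGroup Γ) {l : List (Matrix n n K)}
    (hl : ∀ x ∈ l, x ∈ tangent Γ) {p : MvPolynomial (n × n) K} (hp : p ∈ vanishingIdeal Γ) :
    wordDer l p ∈ vanishingIdeal Γ := by
  induction l with
  | nil => exact hp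
  | cons x l ih =>
    exact rightDer_mem_vanishingIdeal hΓ (hl x (by simp)) (ih fun y hy => hl y (by simp [hy]))

/-- The ideal of the polynomials all of whose iterated derivatives along the tangent space vanish
at the identity. -/
def jetIdeal (Γ : Set (Matrix n n K)) : Ideal (MvPolynomial (n × n) K) where
  carrier := {p | ∀ l : List (Matrix n n K), (∀ x ∈ l, x ∈ tangent Γ) →
    ev (1 : Matrix n n K) (wordDer l p) = 0}
  zero_mem' := fun l _ => by rw [wordDer_zero, map_zero]
  add_mem' := fun hp hq l hl => by rw [wordDer_add, map_add, hp l hl, hq l hl, add_zero]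
  smul_mem' := by
    intro c p hp l hl
    -- The last letter of the word is the first to be applied to `c * p`; the Leibniz rule then
    -- leaves two products and a shorter word.
    induction l using List.reverseRecOn generalizing c p with
    | nil => simpa using Or.inr (hp [] (by simp))
    | append_singleton l x ih =>
      have hl' : ∀ y ∈ l, y ∈ tangent Γ := fun y hy => hl y (by simp [hy])
      rw [wordDer_append, wordDer_cons, wordDer_nil, smul_eq_mul, Derivation.leibniz, wordDer_add,
        map_add, smul_eq_mul, smul_eq_mul, mul_comm p]
      have h1 := ih c (p := rightDer x p) (fun m hm => by
        have := hp (m ++ [x]) (by simpa [or_imp, forall_and] using ⟨hm, hl x (by simp)⟩)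
        rwa [wordDer_append] at this) hl'
      have h2 := ih (rightDer x c) hp hl'
      rw [smul_eq_mul] at h1 h2
      rw [h1, h2, add_zero]

lemma wordDer_mem_jetIdeal {p : MvPolynomial (n × n) K} (hp : p ∈ jetIdeal Γ)
    {l : List (Matrix n n K)} (hl : ∀ x ∈ l, x ∈ tangent Γ) : wordDer l p ∈ jetIdeal Γ := by
  intro m hm
  rw [← wordDer_append]
  exact hp _ (by simpa [or_imp, forall_and] using ⟨hm, hl⟩)

lemma vanishingIdeal_le_jetIdeal (hΓ : IsConnectedGroup Γ) : vanishingIdeal Γ ≤ jetIdeal Γ :=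
  fun _ hp _ hl => wordDer_mem_vanishingIdeal hΓ hl hp 1 hΓ.one_mem

/-- There are a derivation preserving the ideals and acting as the identity on the cotangent space
(an Euler vector field). -/
lemma exists_euler (hΓ : IsConnectedGroup Γ) :
    ∃ E : Derivation K (MvPolynomial (n × n) K) (MvPolynomial (n × n) K),
      (∀ p ∈ vanishingIdeal Γ, E p ∈ vanishingIdeal Γ) ∧
      (∀ p, E p ∈ maxOne n K) ∧
      (∀ p ∈ jetIdeal Γ, E p ∈ maxOne n K * jetIdeal Γ) ∧
      ∀ p ∈ maxOne n K, E p - p ∈ vanishingIdeal Γ ⊔ maxOne n K ^ 2 := by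
  let b := Module.finBasis K (tangent Γ)
  choose φ hφ using fun i => LinearMap.exists_extend (b.coord i)
  -- The Euler field `∑ x_i ∂_i` for a basis of the tangent space; the linear coordinates `x_i`
  -- extend the dual basis.
  let E : Derivation K (MvPolynomial (n × n) K) (MvPolynomial (n × n) K) :=
    ∑ i, linearPoly (φ i) • rightDer (b i : Matrix n n K)
  have hE : ∀ p, E p = ∑ i, linearPoly (φ i) * rightDer (b i : Matrix n n K) p := fun p => by
    change Derivation.coeFnAddMonoidHom (∑ i, linearPoly (φ i) • rightDer (b i : Matrix n n K)) p = _
    rw [map_sum, Finset.sum_apply]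
    rfl
  have hEm : ∀ p, E p ∈ maxOne n K := fun p => by
    rw [hE]
    exact Ideal.sum_mem _ fun i _ => Ideal.mul_mem_right _ _ (linearPoly_mem _)
  refine ⟨E, fun p hp => ?_, hEm, fun p hp => ?_, fun p hp => ?_⟩
  · rw [hE]
    exact Ideal.sum_mem _ fun i _ =>
      Ideal.mul_mem_left _ _ (rightDer_mem_vanishingIdeal hΓ (b i).2 hp)
  · rw [hE]
    refine Ideal.sum_mem _ fun i _ => Ideal.mul_mem_mul (linearPoly_mem _) ?_
    have := wordDer_mem_jetIdeal hp (l := [(b i : Matrix n n K)]) (by simp)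
    simpa using this
  · refine mem_sup_sq (sub_mem (hEm p) hp) hΓ.one_mem fun x hx => ?_
    have h1 : x = ∑ i, φ i x • (b i : Matrix n n K) := by
      have h2 := congrArg Subtype.val (b.sum_repr ⟨x, hx⟩)
      rw [Submodule.coe_sum] at h2
      refine h2.symm.trans (Finset.sum_congr rfl fun i _ => ?_)
      have h3 := LinearMap.congr_fun (hφ i) ⟨x, hx⟩
      simp only [LinearMap.comp_apply, Submodule.subtype_apply, Module.Basis.coord_apply] at h3
      rw [h3, Submodule.coe_smul]
    rw [map_sub, LinearMap.sub_apply, sub_eq_zero, hE, map_sum, LinearMap.sum_apply]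
    conv_rhs => rw [h1, map_sum]
    refine Finset.sum_congr rfl fun i _ => ?_
    rw [diffOne_mul, diffOne_linearPoly, mem_maxOne.1 (linearPoly_mem _), zero_mul, zero_add,
      map_smul, smul_eq_mul, mul_comm, diffOne_apply]

/-- By the Leibniz rule, the Euler field multiplies the leading term of a function of order `k` by
`k`. -/
lemma euler_pow (E : Derivation K (MvPolynomial (n × n) K) (MvPolynomial (n × n) K))
    (hEm : ∀ p, E p ∈ maxOne n K)
    (hE : ∀ p ∈ maxOne n K, E p - p ∈ vanishingIdeal Γ ⊔ maxOne n K ^ 2) (k : ℕ) :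
    ∀ p ∈ maxOne n K ^ k, E p - (k : K) • p ∈ vanishingIdeal Γ ⊔ maxOne n K ^ (k + 1) := by
  induction k with
  | zero =>
    intro p _
    refine Submodule.mem_sup_right ?_
    simpa using hEm p
  | succ k ih =>
    intro p hp
    rw [pow_succ] at hp
    refine Submodule.mul_induction_on hp (fun a ha y hy => ?_) fun x y hx hy => ?_
    · have h1 := Ideal.mul_mem_mul (ih a ha) hy
      have h2 := Ideal.mul_mem_mul ha (hE y hy)
      have e1 : (vanishingIdeal Γ ⊔ maxOne n K ^ (k + 1)) * maxOne n K ≤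
          vanishingIdeal Γ ⊔ maxOne n K ^ (k + 1 + 1) := by
        rw [Ideal.sup_mul, ← pow_succ]
        exact sup_le_sup_right Ideal.mul_le_left _
      have e2 : maxOne n K ^ k * (vanishingIdeal Γ ⊔ maxOne n K ^ 2) ≤
          vanishingIdeal Γ ⊔ maxOne n K ^ (k + 1 + 1) := by
        rw [Ideal.mul_sup, ← pow_add]
        exact sup_le_sup_right Ideal.mul_le_right _
      convert add_mem (e1 h1) (e2 h2) using 1
      simp only [Derivation.leibniz, smul_eq_mul, Nat.cast_add, Nat.cast_one, add_smul, one_smul,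
        sub_mul, mul_sub, smul_mul_assoc]
      ring
    · convert add_mem hx hy using 1
      rw [map_add, smul_add]
      ring

/-- If `p` in the jet ideal has order at least `k` modulo the vanishing ideal, then `E p` has order
at least `k + 1`, since `E` maps the jet ideal `J` into `m J`. But `E p` is also `k p` up to order
`k + 1`, and `k` is invertible. The case `k = 0` only needs that the functions in `J` vanish at 1.
-/
lemma jetIdeal_le [CharZero K] (hΓ : IsConnectedGroup Γ) (k : ℕ) :
    jetIdeal Γ ≤ vanishingIdeal Γ ⊔ maxOne n K ^ k := by
  obtain ⟨E, hEI, hEm, hEJ, hE⟩ := exists_euler hΓ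
  have hJm : jetIdeal Γ ≤ maxOne n K := fun p hp => hp [] (by simp)
  induction k with
  | zero => simp
  | succ k ih =>
    rcases Nat.eq_zero_or_pos k with rfl | hk
    · simpa using hJm.trans le_sup_right
    intro p hp
    obtain ⟨i, hi, g, hg, rfl⟩ := Submodule.mem_sup.1 (ih hp)
    have h1 := euler_pow E hEm hE k g hg
    have h2 : E (i + g) ∈ vanishingIdeal Γ ⊔ maxOne n K ^ (k + 1) := by
      have : maxOne n K * jetIdeal Γ ≤ vanishingIdeal Γ ⊔ maxOne n K ^ (k + 1) := by
        refine (Ideal.mul_mono_right ih).trans ?_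
        rw [Ideal.mul_sup, ← pow_succ']
        exact sup_le_sup_right Ideal.mul_le_right _
      exact this (hEJ _ hp)
    have h3 : E i - (k : K) • i ∈ vanishingIdeal Γ ⊔ maxOne n K ^ (k + 1) :=
      Submodule.mem_sup_left (sub_mem (hEI i hi)
        (((vanishingIdeal Γ).restrictScalars K).smul_mem _ hi))
    have h4 : (k : K) • (i + g) ∈ vanishingIdeal Γ ⊔ maxOne n K ^ (k + 1) := by
      convert sub_mem h2 (add_mem h3 h1) using 1
      rw [map_add, smul_add]
      ring
    have hk0 : (k : K) ≠ 0 := by exact_mod_cast hk.ne'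
    have h5 := ((vanishingIdeal Γ ⊔ maxOne n K ^ (k + 1)).restrictScalars K).smul_mem
      (k : K)⁻¹ h4
    rwa [smul_smul, inv_mul_cancel₀ hk0, one_smul] at h5

/-- Krull's intersection theorem on the group. -/
lemma exists_mul_mem [CharZero K] (hΓ : IsConnectedGroup Γ) {p : MvPolynomial (n × n) K}
    (hp : p ∈ jetIdeal Γ) : ∃ b, ev (1 : Matrix n n K) b ≠ 0 ∧ b * p ∈ vanishingIdeal Γ := by
  have h : (Ideal.Quotient.mk (vanishingIdeal Γ) p) ∈ (⨅ i : ℕ, maxOne n K ^ i • ⊤ :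
      Submodule (MvPolynomial (n × n) K) (MvPolynomial (n × n) K ⧸ vanishingIdeal Γ)) := by
    rw [Submodule.mem_iInf]
    intro k
    obtain ⟨i, hi, g, hg, rfl⟩ := Submodule.mem_sup.1 (jetIdeal_le hΓ k hp)
    rw [map_add, Ideal.Quotient.eq_zero_iff_mem.2 hi, zero_add]
    have := Submodule.smul_mem_smul hg (Submodule.mem_top (x :=
      (1 : MvPolynomial (n × n) K ⧸ vanishingIdeal Γ)) (R := MvPolynomial (n × n) K))
    change Ideal.Quotient.mk _ (g * 1) ∈ _ at this
    rwa [mul_one] at this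
  rw [Ideal.mem_iInf_smul_pow_eq_bot_iff] at h
  obtain ⟨⟨r, hr⟩, h⟩ := h
  refine ⟨1 - r, by simp [mem_maxOne.1 hr], ?_⟩
  rw [← Ideal.Quotient.eq_zero_iff_mem, sub_mul, map_sub, one_mul, sub_eq_zero]
  exact h.symm

/-- One factor `b` for the whole jet ideal: the product of the factors that serve its finitely many
generators. -/
lemma exists_forall_mul_mem [CharZero K] (hΓ : IsConnectedGroup Γ) :
    ∃ b, ev (1 : Matrix n n K) b ≠ 0 ∧ ∀ p ∈ jetIdeal Γ, b * p ∈ vanishingIdeal Γ := by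
  obtain ⟨s, hs⟩ := (isNoetherianRing_iff_ideal_fg (MvPolynomial (n × n) K)).1 inferInstance
    (jetIdeal Γ)
  have hsJ : ∀ p ∈ s, p ∈ jetIdeal Γ := fun p hp => hs ▸ Submodule.subset_span hp
  choose! c hc1 hc2 using fun p (hp : p ∈ jetIdeal Γ) => exists_mul_mem hΓ hp
  refine ⟨∏ p ∈ s, c p, ?_, fun p hp => ?_⟩
  · rw [map_prod, Finset.prod_ne_zero_iff]
    exact fun p hp => hc1 p (hsJ p hp)
  · rw [← hs] at hp
    refine Submodule.span_induction (fun q hq => ?_) (by simp) (fun x y _ _ hx hy => ?_)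
      (fun a x _ hx => ?_) hp
    · classical
      rw [← Finset.mul_prod_erase s c hq, mul_comm (c q), mul_assoc]
      exact Ideal.mul_mem_left _ _ (hc2 q (hsJ q hq))
    · rw [mul_add]
      exact add_mem hx hy
    · rw [smul_eq_mul, mul_left_comm]
      exact Ideal.mul_mem_left _ _ hx

/-- On a connected group, a polynomial function is zero as soon as all its iterated derivatives
along the tangent space at the identity vanish at the identity. -/
theorem jetIdeal_eq [CharZero K] (hΓ : IsConnectedGroup Γ) : jetIdeal Γ = vanishingIdeal Γ := by
  refine le_antisymm (fun f hf => ?_) (vanishingIdeal_le_jetIdeal hΓ)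
  obtain ⟨b, hb1, hb⟩ := exists_forall_mul_mem hΓ
  -- The zero locus `S` is closed in `Γ` and stable under products. It contains the neighbourhood `b
  -- ≠ 0` of 1 in `Γ`, hence a translated neighbourhood of each of its points. So `S` is open and
  -- closed, and equals `Γ`.
  let S : Set (Matrix n n K) := {g | g ∈ Γ ∧ ∀ p ∈ jetIdeal Γ, ev g p = 0}
  have hSmul : ∀ g ∈ S, ∀ h ∈ S, g * h ∈ S := by
    intro g hg h hh
    refine ⟨hΓ.mul_mem g hg.1 h hh.1, fun p hp => ?_⟩
    rw [← ev_leftTranslate]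
    refine hh.2 _ fun l hl => ?_
    rw [wordDer_leftTranslate, ev_leftTranslate, mul_one]
    exact hg.2 _ (wordDer_mem_jetIdeal hp hl)
  have hone : 1 ∈ S := ⟨hΓ.one_mem, fun p hp => hp [] (by simp)⟩
  have key : ∀ g ∈ Γ, g ∈ S := by
    by_contra! hne
    obtain ⟨g₀, hg₀, hg₀S⟩ := hne
    have hex : ∀ g ∈ Γ, g ∉ S → ∃ p ∈ (jetIdeal Γ : Set (MvPolynomial (n × n) K)),
        ev g p ≠ 0 := fun g hg hgS => by
      by_contra! hcon
      exact hgS ⟨hg, hcon⟩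
    -- The open set `B` is the union over `h ∈ S` of the sets `b(h⁻¹ g) ≠ 0`; the open set `A` is
    -- the complement of `S`.
    have hB : ∀ g ∈ S, ∃ p ∈ {q | ∃ h ∈ S, ∃ h' ∈ Γ, h * h' = 1 ∧ q = leftTranslate h' b},
        ev g p ≠ 0 := fun g hg => by
      obtain ⟨h', hh', e⟩ := hΓ.exists_inv g hg.1
      refine ⟨_, ⟨g, hg, h', hh', e, rfl⟩, ?_⟩
      rwa [ev_leftTranslate, mul_eq_one_comm.1 e]
    obtain ⟨g, hg, ⟨p, hp, hgp⟩, q, ⟨h, hh, h', hh', e, rfl⟩, hgq⟩ := hΓ.connected _ _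
      (fun g hg => by
        by_cases hgS : g ∈ S
        · exact Or.inr (hB g hgS)
        · exact Or.inl (hex g hg hgS)) ⟨g₀, hg₀, hex g₀ hg₀ hg₀S⟩ ⟨1, hΓ.one_mem, hB 1 hone⟩
    rw [ev_leftTranslate] at hgq
    have h1 : h' * g ∈ S := by
      refine ⟨hΓ.mul_mem _ hh' _ hg, fun r hr => ?_⟩
      have := hb r hr _ (hΓ.mul_mem _ hh' _ hg)
      rw [map_mul] at this
      exact (mul_eq_zero.1 this).resolve_left hgq
    have h2 := hSmul h hh _ h1
    rw [← mul_assoc, e, one_mul] at h2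
    exact hgp (h2.2 p hp)
  exact fun g hg => (key g hg).2 f hf

end MatPoly

/-! ### Diagonalization, and the function that detects a ratio of eigenvalues -/

namespace MatPoly

open MvPolynomial
open scoped Kronecker

variable {n : Type*} [Fintype n] [DecidableEq n] {K : Type*} [Field K]

section Diagonalization

variable {u : Matrix n n K} {P : (Matrix n n K)ˣ} {μ : n → K}

/-- The diagonal entries of a matrix in the basis given by the columns of `P`. -/
def diagCoord (P : (Matrix n n K)ˣ) (i : n) : Matrix n n K →ₗ[K] K where
  toFun x := ((P⁻¹ : (Matrix n n K)ˣ).val * x * P.val) i i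
  map_add' x y := by simp [mul_add, add_mul]
  map_smul' c x := by simp

lemma diagCoord_apply (P : (Matrix n n K)ˣ) (i : n) (x : Matrix n n K) :
    diagCoord P i x = ((P⁻¹ : (Matrix n n K)ˣ).val * x * P.val) i i := rfl

lemma mul_eq_of_commute (hμ : Function.Injective μ) (hu : u * P.val = P.val * Matrix.diagonal μ)
    {x : Matrix n n K} (hx : x * u = u * x) :
    x * P.val = P.val * Matrix.diagonal (fun i => diagCoord P i x) := by
  set y := (P⁻¹ : (Matrix n n K)ˣ).val * x * P.val with hy
  have hPy : P.val * y = x * P.val := by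
    rw [hy, ← mul_assoc, ← mul_assoc, Units.mul_inv, one_mul]
  have h1 : P.val * (y * Matrix.diagonal μ) = P.val * (Matrix.diagonal μ * y) := by
    rw [← mul_assoc, hPy, mul_assoc, ← hu, ← mul_assoc, hx, ← mul_assoc, ← hu, mul_assoc, mul_assoc,
      hPy]
  have h2 : y * Matrix.diagonal μ = Matrix.diagonal μ * y := P.isUnit.mul_left_cancel h1
  have h3 : y = Matrix.diagonal (fun i => diagCoord P i x) := by
    ext i j
    rcases eq_or_ne i j with rfl | hij
    · rw [Matrix.diagonal_apply_eq, diagCoord_apply]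
    · rw [Matrix.diagonal_apply_ne _ hij]
      have := congrFun (congrFun h2 i) j
      rw [Matrix.mul_diagonal, Matrix.diagonal_mul] at this
      by_contra h0
      rw [mul_comm] at this
      exact hij (hμ (mul_right_cancel₀ h0 this)).symm
  rw [← hPy, ← h3]

lemma commute_of_mul_eq {x y : Matrix n n K} {τ σ : n → K}
    (hx : x * P.val = P.val * Matrix.diagonal τ) (hy : y * P.val = P.val * Matrix.diagonal σ) :
    x * y = y * x := by
  have h : x * y * P.val = y * x * P.val := by
    rw [mul_assoc x, hy, ← mul_assoc x, hx, mul_assoc y, hx, ← mul_assoc y, hy, mul_assoc, mul_assoc,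
      Matrix.diagonal_mul_diagonal, Matrix.diagonal_mul_diagonal]
    congr 2
    exact funext fun i => mul_comm _ _
  exact P.isUnit.mul_right_cancel h

/-- The operator `ad u` is semisimple on its generalized kernel. -/
lemma commute_of_commutator_commute
    (hu : u * P.val = P.val * Matrix.diagonal μ) {x : Matrix n n K}
    (hx : (x * u - u * x) * u = u * (x * u - u * x)) : x * u = u * x := by
  set Q := (P⁻¹ : (Matrix n n K)ˣ).val
  have hu' : Q * u = Matrix.diagonal μ * Q := by
    apply P.isUnit.mul_right_cancel
    apply P.isUnit.mul_left_cancel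
    rw [mul_assoc, hu, mul_assoc, Units.inv_mul, mul_one, ← mul_assoc, ← mul_assoc, Units.mul_inv,
      one_mul]
  have hconj : ∀ z : Matrix n n K, Q * (z * u - u * z) * P.val =
      (Q * z * P.val) * Matrix.diagonal μ - Matrix.diagonal μ * (Q * z * P.val) := fun z => by
    rw [mul_sub, sub_mul]
    congr 1
    · simp only [mul_assoc, hu]
    · simp only [← mul_assoc, hu']
  have hent : ∀ z : Matrix n n K, ∀ i j, (Q * (z * u - u * z) * P.val) i j =
      (μ j - μ i) * (Q * z * P.val) i j := fun z i j => by
    rw [hconj, Matrix.sub_apply, Matrix.mul_diagonal, Matrix.diagonal_mul]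
    ring
  have h0 : Q * (x * u - u * x) * P.val = 0 := by
    ext i j
    have h1 := hent (x * u - u * x) i j
    rw [sub_eq_zero.2 hx, hent x] at h1
    simp only [mul_zero, zero_mul, Matrix.zero_apply] at h1
    rw [hent x, Matrix.zero_apply]
    rcases mul_eq_zero.1 h1.symm with h | h
    · rw [h, zero_mul]
    · exact h
  rw [← sub_eq_zero]
  apply P.isUnit.mul_right_cancel
  apply (P⁻¹).isUnit.mul_left_cancel
  rw [← mul_assoc, h0, zero_mul, mul_zero]

end Diagonalization

/-- A function of `g` that vanishes if and only if `r` is a quotient of two eigenvalues of `g`. -/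
def ratioPoly (n : Type*) [Fintype n] [DecidableEq n] (r : K) : MvPolynomial (n × n) K :=
  ((C r : MvPolynomial (n × n) K) • (Matrix.mvPolynomialX n n K ⊗ₖ (1 : Matrix n n (MvPolynomial (n × n) K))) -
    (1 : Matrix n n (MvPolynomial (n × n) K)) ⊗ₖ Matrix.mvPolynomialX n n K).det

omit [Fintype n] [DecidableEq n] in
lemma ev_C (g : Matrix n n K) (c : K) : ev g (C c : MvPolynomial (n × n) K) = c := by
  rw [ev, aeval_C]
  rfl

omit [Fintype n] [DecidableEq n] in
lemma ext_ev [Infinite K] {p q : MvPolynomial (n × n) K}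
    (h : ∀ g : Matrix n n K, ev g p = ev g q) : p = q :=
  MvPolynomial.funext fun v => by
    have hv : ∀ p : MvPolynomial (n × n) K, eval v p = ev (Matrix.of fun i j => v (i, j)) p :=
      fun p => (RingHom.congr_fun (MvPolynomial.coe_aeval_eq_eval v) p).symm
    rw [hv, hv, h]

lemma ev_ratioPoly (r : K) (g : Matrix n n K) :
    ev g (ratioPoly n r) = (r • (g ⊗ₖ (1 : Matrix n n K)) - (1 : Matrix n n K) ⊗ₖ g).det := by
  rw [ratioPoly, AlgHom.map_det]
  congr 1
  ext ⟨i, j⟩ ⟨k, l⟩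
  simp only [AlgHom.mapMatrix_apply, Matrix.map_apply, Matrix.sub_apply, Matrix.smul_apply,
    Matrix.kronecker_apply, Matrix.mvPolynomialX_apply, smul_eq_mul, map_sub, map_mul, ev_X, ev_C,
    Matrix.one_apply, apply_ite (ev g), map_one, map_zero]

/-- The matrices `a g` and `g a` are conjugate by `a`, and `a ⊗ a` intertwines the two Kronecker
expressions. -/
lemma ev_ratioPoly_mul_comm (r : K) (a : (Matrix n n K)ˣ) (g : Matrix n n K) :
    ev (a.val * g) (ratioPoly n r) = ev (g * a.val) (ratioPoly n r) := by
  rw [ev_ratioPoly, ev_ratioPoly]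
  have h : (r • ((a.val * g) ⊗ₖ (1 : Matrix n n K)) - (1 : Matrix n n K) ⊗ₖ (a.val * g)) *
      (a.val ⊗ₖ a.val) = (a.val ⊗ₖ a.val) *
        (r • ((g * a.val) ⊗ₖ (1 : Matrix n n K)) - (1 : Matrix n n K) ⊗ₖ (g * a.val)) := by
    rw [sub_mul, mul_sub, smul_mul_assoc, mul_smul_comm, ← Matrix.mul_kronecker_mul,
      ← Matrix.mul_kronecker_mul, ← Matrix.mul_kronecker_mul, ← Matrix.mul_kronecker_mul, one_mul,
      mul_one, mul_assoc]
  have hdet : (a.val ⊗ₖ a.val).det ≠ 0 := by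
    rw [Matrix.det_kronecker]
    have := ((Matrix.isUnit_iff_isUnit_det _).1 a.isUnit).ne_zero
    exact mul_ne_zero (pow_ne_zero _ this) (pow_ne_zero _ this)
  have h2 := congrArg Matrix.det h
  rw [Matrix.det_mul, Matrix.det_mul, mul_comm] at h2
  exact mul_left_cancel₀ hdet h2

lemma ev_one_ratioPoly {r : K} (hr : r ≠ 1) :
    ev (1 : Matrix n n K) (ratioPoly n r) ≠ 0 := by
  rw [ev_ratioPoly, Matrix.one_kronecker_one]
  have : r • (1 : Matrix (n × n) (n × n) K) - 1 = (r - 1) • 1 := by rw [sub_smul, one_smul]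
  rw [this, Matrix.det_smul, Matrix.det_one, mul_one]
  exact pow_ne_zero _ (sub_ne_zero.2 hr)

lemma ev_ratioPoly_eq_zero {r : K} {P : (Matrix n n K)ˣ} {g : Matrix n n K} {σ : n → K}
    (hg : g * P.val = P.val * Matrix.diagonal σ) {i j : n} (hr : σ j = r * σ i) :
    ev g (ratioPoly n r) = 0 := by
  rw [ev_ratioPoly, ← Matrix.exists_mulVec_eq_zero_iff]
  have hcol : ∀ k, ∃ a, P.val a k ≠ 0 := fun k => by
    by_contra! hcon
    have h1 : ((P⁻¹ : (Matrix n n K)ˣ).val * P.val) k k = 0 := by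
      rw [Matrix.mul_apply]
      exact Finset.sum_eq_zero fun a _ => by rw [hcon, mul_zero]
    rw [Units.inv_mul, Matrix.one_apply_eq] at h1
    exact one_ne_zero h1
  have hgk : ∀ a k, ∑ b, g a b * P.val b k = P.val a k * σ k := fun a k => by
    have := congrFun (congrFun hg a) k
    rwa [Matrix.mul_apply, Matrix.mul_diagonal] at this
  -- The tensor product of the eigenvectors `i` and `j` is an eigenvector with eigenvalue `r σ_i -
  -- σ_j = 0`.
  refine ⟨fun ab => P.val ab.1 i * P.val ab.2 j, fun h => ?_, ?_⟩
  · obtain ⟨a, ha⟩ := hcol i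
    obtain ⟨b, hb⟩ := hcol j
    exact mul_ne_zero ha hb (congrFun h (a, b))
  · ext ⟨a, b⟩
    rw [Matrix.sub_mulVec, Matrix.smul_mulVec]
    simp only [Pi.sub_apply, Pi.smul_apply, Matrix.mulVec, dotProduct, Matrix.kronecker_apply,
      Fintype.sum_prod_type, Matrix.one_apply, smul_eq_mul, Pi.zero_apply, mul_ite, mul_one,
      mul_zero, ite_mul, zero_mul, Finset.sum_ite_eq, Finset.mem_univ, if_true, one_mul]
    have h1 : ∑ x, g a x * (P.val x i * P.val b j) = P.val a i * σ i * P.val b j := by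
      rw [← hgk, Finset.sum_mul]
      exact Finset.sum_congr rfl fun _ _ => by ring
    have h2 : ∑ x, g b x * (P.val a i * P.val x j) = P.val b j * σ j * P.val a i := by
      rw [← hgk, Finset.sum_mul]
      exact Finset.sum_congr rfl fun _ _ => by ring
    have h3 : ∑ x, ∑ y, (if a = x then g b y * (P.val x i * P.val y j) else 0) =
        ∑ x, g b x * (P.val a i * P.val x j) := by
      rw [Finset.sum_comm]
      simp
    rw [h1, h3, h2, hr]
    ring

lemma eval_det_one_add_smul (x : Matrix n n K) (s : K) :
    Polynomial.eval s (1 + (Polynomial.X : Polynomial K) • x.map Polynomial.C :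
      Matrix n n (Polynomial K)).det = (1 + s • x).det := by
  have h := RingHom.map_det (Polynomial.evalRingHom s)
    (1 + (Polynomial.X : Polynomial K) • x.map Polynomial.C : Matrix n n (Polynomial K))
  rw [Polynomial.coe_evalRingHom] at h
  rw [h]
  congr 1
  ext i j
  rw [RingHom.mapMatrix_apply, Matrix.map_apply, Matrix.add_apply, Matrix.smul_apply,
    Matrix.map_apply, Matrix.add_apply, Matrix.smul_apply, Polynomial.coe_evalRingHom,
    Polynomial.eval_add, smul_eq_mul, smul_eq_mul, Polynomial.eval_mul, Polynomial.eval_X,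
    Polynomial.eval_C, Matrix.one_apply, Matrix.one_apply]
  split_ifs <;> simp

lemma exists_det_poly (x : Matrix n n K) :
    ∃ D : Polynomial K, D ≠ 0 ∧ ∀ s, D.eval s = (1 + s • x).det := by
  refine ⟨_, fun h => ?_, eval_det_one_add_smul x⟩
  have h0 := eval_det_one_add_smul x 0
  rw [h, Polynomial.eval_zero, zero_smul, add_zero, Matrix.det_one] at h0
  exact zero_ne_one h0

/-- Invariance gives `F((1 + s x) g) = F(g (1 + s x))` only where `det(1 + s x) ≠ 0`. Multiplied by
this determinant, a nonzero polynomial in `s`, the identity holds for all `s`, and the determinant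
cancels in `K[s]`. -/
lemma ev_line_comm [Infinite K] {F : MvPolynomial (n × n) K}
    (hF : ∀ (a : (Matrix n n K)ˣ) (g : Matrix n n K), ev (a.val * g) F = ev (g * a.val) F)
    (x g : Matrix n n K) :
    ev (g.map Polynomial.C + Polynomial.X (R := K) • (x * g).map Polynomial.C) F =
      ev (g.map Polynomial.C + Polynomial.X (R := K) • (g * x).map Polynomial.C) F := by
  obtain ⟨D, hD0, hDs⟩ := exists_det_poly x
  refine mul_right_cancel₀ hD0 (Polynomial.funext fun s => ?_)
  rw [Polynomial.eval_mul, Polynomial.eval_mul, eval_ev_line, eval_ev_line, hDs]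
  by_cases h : (1 + s • x).det = 0
  · rw [h, mul_zero, mul_zero]
  · congr 1
    have hu : IsUnit (1 + s • x) := (Matrix.isUnit_iff_isUnit_det _).2 (isUnit_iff_ne_zero.2 h)
    have := hF hu.unit g
    rw [hu.unit_spec, add_mul, mul_add, one_mul, mul_one, smul_mul_assoc, mul_smul_comm] at this
    exact this

/-- Infinitesimal form of conjugation invariance. -/
lemma leftDer_eq_rightDer_of_mul_comm [Infinite K] {F : MvPolynomial (n × n) K}
    (hF : ∀ (a : (Matrix n n K)ˣ) (g : Matrix n n K), ev (a.val * g) F = ev (g * a.val) F)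
    (x : Matrix n n K) : leftDer x F = rightDer x F := by
  refine ext_ev fun g => ?_
  rw [ev_derivation_eq _ g (x * g) (ev_leftDer_X x g),
    ev_derivation_eq _ g (g * x) (ev_rightDer_X x g), ev_line_comm hF]

end MatPoly

/-! ### Weights of the centralizer on the Lie algebra of a connected group -/

namespace MatPoly

open MvPolynomial

variable {n : Type*} [Fintype n] [DecidableEq n] {K : Type*} [Field K]
  {Γ : Set (Matrix n n K)}

/-- Composition of polynomial functions with conjugation by `u`. -/
def conjPoly (u : (Matrix n n K)ˣ) : MvPolynomial (n × n) K →ₐ[K] MvPolynomial (n × n) K :=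
  aeval fun ij => ((u⁻¹ : (Matrix n n K)ˣ).val.map (C : K → MvPolynomial (n × n) K) *
    Matrix.mvPolynomialX n n K * u.val.map (C : K → MvPolynomial (n × n) K) :
      Matrix n n (MvPolynomial (n × n) K)) ij.1 ij.2

lemma ev_conjPoly {A : Type*} [CommRing A] [Algebra K A] (u : (Matrix n n K)ˣ)
    (g : Matrix n n A) (p : MvPolynomial (n × n) K) :
    ev g (conjPoly u p) = ev ((u⁻¹ : (Matrix n n K)ˣ).val.map (algebraMap K A) * g *
      u.val.map (algebraMap K A)) p := by
  have : (ev g).comp (conjPoly u) = ev (K := K) ((u⁻¹ : (Matrix n n K)ˣ).val.map (algebraMap K A) *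
      g * u.val.map (algebraMap K A)) := by
    ext ij
    simp [conjPoly, Matrix.mul_apply, ev, Matrix.mvPolynomialX]
  exact congrArg (fun f => f p) this

lemma inv_mem (hΓ : IsConnectedGroup Γ) {u : (Matrix n n K)ˣ} (hu : u.val ∈ Γ) :
    (u⁻¹ : (Matrix n n K)ˣ).val ∈ Γ := by
  obtain ⟨h, hh, e⟩ := hΓ.exists_inv _ hu
  rwa [Units.inv_eq_of_mul_eq_one_right e]

lemma conj_mem_tangent (hΓ : IsConnectedGroup Γ) {u : (Matrix n n K)ˣ} (hu : u.val ∈ Γ)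
    {x : Matrix n n K} (hx : x ∈ tangent Γ) :
    (u⁻¹ : (Matrix n n K)ˣ).val * x * u.val ∈ tangent Γ := by
  intro p hp
  have h : conjPoly u p ∈ vanishingIdeal Γ := fun g hg => by
    rw [ev_conjPoly]
    exact hp _ (hΓ.mul_mem _ (hΓ.mul_mem _ (inv_mem hΓ hu) _ hg) _ hu)
  have h1 := hx _ h
  rw [diffOne_apply, ev_derivation_eq _ 1 x (fun ij => by rw [ev_rightDer_X, one_mul]),
    ev_conjPoly] at h1
  rw [diffOne_apply, ev_derivation_eq _ 1 ((u⁻¹ : (Matrix n n K)ˣ).val * x * u.val)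
    (fun ij => by rw [ev_rightDer_X, one_mul])]
  convert h1 using 5
  rw [mul_add, add_mul, mul_smul_comm, smul_mul_assoc, Matrix.map_mul, Matrix.map_mul,
    Matrix.map_one _ (map_zero _) (map_one _), mul_one]
  congr 1
  have := congrArg (fun m : Matrix n n K => m.map (Polynomial.C : K → Polynomial K)) u.inv_mul
  rw [Matrix.map_mul, Matrix.map_one _ (map_zero _) (map_one _)] at this
  exact this.symm

/-- The operator `Ad(u⁻¹) - 1` on the tangent space. -/
def adSubOne (hΓ : IsConnectedGroup Γ) {u : (Matrix n n K)ˣ} (hu : u.val ∈ Γ) :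
    tangent Γ →ₗ[K] tangent Γ where
  toFun x := ⟨(u⁻¹ : (Matrix n n K)ˣ).val * x * u.val - x,
    sub_mem (conj_mem_tangent hΓ hu x.2) x.2⟩
  map_add' x y := Subtype.ext (by simp [mul_add, add_mul]; abel)
  map_smul' c x := Subtype.ext (by simp [smul_sub])

/-- As `u` is diagonalizable, the kernel and the range of `Ad(u⁻¹) - 1` on the tangent space meet
only in 0, so by rank and nullity they span it. The kernel is the centralizer of `u`. -/
lemma exists_decomposition (hΓ : IsConnectedGroup Γ) {u : (Matrix n n K)ˣ} (hu : u.val ∈ Γ)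
    {P : (Matrix n n K)ˣ} {μ : n → K} (hP : u.val * P.val = P.val * Matrix.diagonal μ)
    {x : Matrix n n K} (hx : x ∈ tangent Γ) :
    ∃ c ∈ tangent Γ, c * u.val = u.val * c ∧ ∃ y ∈ tangent Γ,
      x = c + ((u⁻¹ : (Matrix n n K)ˣ).val * y * u.val - y) := by
  set T := adSubOne hΓ hu with hT
  have hTu : ∀ y : tangent Γ, u.val * (T y : Matrix n n K) = y * u.val - u.val * y := fun y => by
    change u.val * ((u⁻¹ : (Matrix n n K)ˣ).val * y * u.val - y) = _
    rw [mul_sub, ← mul_assoc, ← mul_assoc, Units.mul_inv, one_mul]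
  have hker : ∀ y : tangent Γ, T y = 0 ↔ (y : Matrix n n K) * u.val = u.val * y := fun y => by
    rw [← sub_eq_zero (b := u.val * (y : Matrix n n K)), ← hTu, ← Subtype.coe_inj]
    refine ⟨fun h => by rw [h, ZeroMemClass.coe_zero, mul_zero], fun h => ?_⟩
    rw [← mul_zero u.val] at h
    exact u.isUnit.mul_left_cancel h
  have hdisj : Disjoint (LinearMap.ker T) (LinearMap.range T) := by
    rw [Submodule.disjoint_def]
    rintro _ hy ⟨x, rfl⟩
    rw [LinearMap.mem_ker, hker] at hy
    rw [hker]
    refine commute_of_commutator_commute hP ?_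
    rw [← hTu, mul_assoc, hy]
  have htop : LinearMap.ker T ⊔ LinearMap.range T = ⊤ := by
    refine Submodule.eq_top_of_disjoint _ _ ?_ hdisj
    rw [add_comm, LinearMap.finrank_range_add_finrank_ker]
  obtain ⟨c, hc, _, ⟨y, rfl⟩, hcy⟩ := Submodule.mem_sup.1 (htop ▸ Submodule.mem_top :
    (⟨x, hx⟩ : tangent Γ) ∈ LinearMap.ker T ⊔ LinearMap.range T)
  exact ⟨c, c.2, (hker c).1 hc, y, y.2, (congrArg Subtype.val hcy).symm⟩

/-- If all words of length less than `N` kill `F` at `u`, then the value at `u` of the derivative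
along a word of length `N` does not depend on the order of the letters. -/
lemma ev_wordDer_perm (hΓ : IsConnectedGroup Γ) {u : Matrix n n K} {F : MvPolynomial (n × n) K}
    {N : ℕ} (hN : ∀ l : List (Matrix n n K), (∀ x ∈ l, x ∈ tangent Γ) → l.length < N →
      ev u (wordDer l F) = 0) {l l' : List (Matrix n n K)} (h : l.Perm l') :
    ∀ m : List (Matrix n n K), (∀ x ∈ m ++ l, x ∈ tangent Γ) → (m ++ l).length = N →
      ev u (wordDer (m ++ l) F) = ev u (wordDer (m ++ l') F) := by
  induction h with
  | nil => intro _ _ _; rfl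
  | cons x _ ih =>
    intro m hm hl
    have := ih (m ++ [x]) (by simpa using hm) (by simpa using hl)
    simpa using this
  | swap x y l =>
    intro m hm hl
    -- Exchanging neighbouring letters costs a word with their commutator as a letter; it is shorter
    -- by one, so it kills `F` at `u`.
    have h1 := hN (m ++ (y * x - x * y) :: l) (fun z hz => by
      rw [List.mem_append, List.mem_cons] at hz
      rcases hz with hz | rfl | hz
      · exact hm z (by simp [hz])
      · exact commutator_mem_tangent hΓ (hm y (by simp)) (hm x (by simp))
      · exact hm z (by simp [hz])) (by rw [← hl]; simp)
    rw [wordDer_append, wordDer_cons, ← rightDer_comm, wordDer_sub, map_sub, sub_eq_zero,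
      ← wordDer_cons, ← wordDer_cons, ← wordDer_cons, ← wordDer_cons, ← wordDer_append,
      ← wordDer_append] at h1
    exact h1
  | trans h1 h2 ih1 ih2 =>
    intro m hm hl
    rw [ih1 m hm hl]
    refine ih2 m (fun z hz => hm z ?_) ?_
    · rw [List.mem_append] at hz ⊢
      exact hz.imp_right h1.mem_iff.2
    · rw [← hl, List.length_append, List.length_append, h1.length_eq]

/-- An infinitesimally conjugation invariant function is flat at `u` if it is flat along the
centralizer of `u`. -/
lemma ev_wordDer_eq_zero (hΓ : IsConnectedGroup Γ) {u : (Matrix n n K)ˣ} (hu : u.val ∈ Γ)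
    {P : (Matrix n n K)ˣ} {μ : n → K} (hP : u.val * P.val = P.val * Matrix.diagonal μ)
    {F : MvPolynomial (n × n) K} (hF : ∀ x, leftDer x F = rightDer x F)
    (hc : ∀ l : List (Matrix n n K), (∀ x ∈ l, x ∈ tangent Γ ∧ x * u.val = u.val * x) →
      ev u.val (wordDer l F) = 0) (l : List (Matrix n n K)) (hl : ∀ x ∈ l, x ∈ tangent Γ) :
    ev u.val (wordDer l F) = 0 := by
  induction hN : l.length using Nat.strong_induction_on generalizing l with
  | _ N ih =>
  have hshort : ∀ l : List (Matrix n n K), (∀ x ∈ l, x ∈ tangent Γ) → l.length < N →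
      ev u.val (wordDer l F) = 0 := fun l hl hlt => ih _ hlt l hl rfl
  have hperm : ∀ l l' : List (Matrix n n K), (∀ x ∈ l, x ∈ tangent Γ) → l.length = N →
      l.Perm l' → ev u.val (wordDer l F) = ev u.val (wordDer l' F) := fun l l' hl hN hp =>
    ev_wordDer_perm hΓ hshort hp [] hl hN
  -- The letters of `c` already centralize `u`. The induction decomposes those of `m` one at a time
  -- and moves their centralizing part into `c`.
  have main : ∀ m c : List (Matrix n n K), (∀ x ∈ m, x ∈ tangent Γ) →
      (∀ x ∈ c, x ∈ tangent Γ ∧ x * u.val = u.val * x) → (m ++ c).length = N →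
      ev u.val (wordDer (m ++ c) F) = 0 := by
    intro m
    induction m with
    | nil => exact fun c _ hc' _ => hc c hc'
    | cons x m ihm =>
      intro c hm hc' hlen
      obtain ⟨a, ha, hau, y, hy, rfl⟩ := exists_decomposition hΓ hu hP (hm x (by simp))
      have hm' : ∀ z ∈ m, z ∈ tangent Γ := fun z hz => hm z (by simp [hz])
      have hmc : ∀ z ∈ m ++ c, z ∈ tangent Γ := fun z hz => by
        rw [List.mem_append] at hz
        exact hz.elim (hm' z) fun hz => (hc' z hz).1
      rw [List.cons_append, wordDer_cons, rightDer_add, Derivation.add_apply, map_add]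
      have h1 : ev u.val (rightDer a (wordDer (m ++ c) F)) = 0 := by
        rw [← wordDer_cons, hperm _ (m ++ (a :: c)) (by simpa using ⟨ha, by simpa using hmc⟩)
          (by simpa using hlen) List.perm_middle.symm]
        exact ihm (a :: c) hm' (by simpa using ⟨⟨ha, hau⟩, hc'⟩)
          (by simp at hlen ⊢; omega)
      -- At `u` the right derivative along `u⁻¹ y u` is the left derivative along `y`. It commutes
      -- with right derivatives, so it can be moved inside to act on `F` directly, where it equals
      -- the right derivative along `y`. The new word is a permutation of the word that starts with
      -- `y`.
      have h2 : ev u.val (rightDer ((u⁻¹ : (Matrix n n K)ˣ).val * y * u.val - y)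
          (wordDer (m ++ c) F)) = 0 := by
        rw [rightDer_sub, Derivation.sub_apply, map_sub, ← ev_rightDer_conj, ← wordDer_leftDer, hF,
          ← wordDer_cons, sub_eq_zero]
        have e : wordDer (m ++ c) (rightDer y F) = wordDer ((m ++ c) ++ [y]) F :=
          (wordDer_append (m ++ c) [y] F).symm
        rw [e]
        refine hperm _ _ ?_ (by simp at hlen ⊢; omega) ?_
        · intro z hz
          rw [List.mem_append, List.mem_singleton] at hz
          rcases hz with hz | rfl
          · exact hmc z hz
          · exact hy
        · exact List.perm_append_singleton y (m ++ c)
      rw [h1, h2, add_zero]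
  have := main l [] hl (by simp) (by simpa using hN)
  simpa using this

/-- In a connected group, the weights of the centralizer of an element with simple spectrum are
distinct on its Lie algebra. -/
theorem exists_diagCoord_ne [CharZero K] (hΓ : IsConnectedGroup Γ) {u : (Matrix n n K)ˣ}
    (hu : u.val ∈ Γ) {P : (Matrix n n K)ˣ} {μ : n → K} (hμ : Function.Injective μ)
    (hP : u.val * P.val = P.val * Matrix.diagonal μ) {i j : n} (hij : i ≠ j) :
    ∃ c ∈ tangent Γ, c * u.val = u.val * c ∧ diagCoord P i c ≠ diagCoord P j c := by
  by_contra! H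
  have hμ0 : μ i ≠ 0 := by
    intro h0
    have h1 : (u.val * P.val).det = 0 := by
      rw [hP, Matrix.det_mul, Matrix.det_diagonal, Finset.prod_eq_zero (Finset.mem_univ i) h0,
        mul_zero]
    exact ((Matrix.isUnit_iff_isUnit_det _).1 (u * P).isUnit).ne_zero h1
  set r := μ j / μ i with hr
  have hr1 : r ≠ 1 := fun h => hij (hμ ((div_eq_one_iff_eq hμ0).1 h)).symm
  have hrμ : μ j = r * μ i := (div_mul_cancel₀ _ hμ0).symm
  set F := ratioPoly n r with hFdef
  -- The induction needs vanishing on the whole family `u z`, with `z` diagonal in the eigenbasis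
  -- and with equal entries at `i` and `j`. By `H` the line `u z (1 + s c)` stays in this family, so
  -- differentiating along `c` preserves vanishing.
  have hB : ∀ l : List (Matrix n n K), (∀ x ∈ l, x ∈ tangent Γ ∧ x * u.val = u.val * x) →
      ∀ (z : Matrix n n K) (τ : n → K), z * P.val = P.val * Matrix.diagonal τ → τ i = τ j →
      ev (u.val * z) (wordDer l F) = 0 := by
    intro l
    induction l with
    | nil =>
      intro _ z τ hz hτ
      refine ev_ratioPoly_eq_zero (P := P) (σ := fun k => μ k * τ k) (i := i) (j := j) ?_ ?_
      · rw [mul_assoc, hz, ← mul_assoc, hP, mul_assoc, Matrix.diagonal_mul_diagonal]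
      · rw [hrμ, ← hτ, mul_assoc]
    | cons c l ih =>
      intro hl z τ hz hτ
      refine ev_rightDer_eq_zero_of_line _ _ _ fun s => ?_
      have hc := hl c (by simp)
      have hc1 := mul_eq_of_commute hμ hP hc.2
      have hc2 := H c hc.1 hc.2
      have e : u.val * z + s • (u.val * z * c) = u.val * (z * (1 + s • c)) := by
        rw [mul_add, mul_one, mul_add, mul_smul_comm, mul_smul_comm, mul_assoc]
      rw [e]
      refine ih (fun x hx => hl x (by simp [hx])) _
        (fun k => τ k * (1 + s * diagCoord P k c)) ?_ (by rw [hτ, hc2])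
      rw [mul_assoc, add_mul, one_mul, smul_mul_assoc, hc1, mul_add, mul_smul_comm, hz,
        ← mul_assoc, hz, mul_assoc, Matrix.diagonal_mul_diagonal, ← mul_smul_comm,
        ← Matrix.diagonal_smul, ← mul_add, Matrix.diagonal_add]
      congr 2
      ext k
      simp
      ring
  have hflat := ev_wordDer_eq_zero hΓ hu hP
    (leftDer_eq_rightDer_of_mul_comm (ev_ratioPoly_mul_comm r))
    (fun l hl => by
      have := hB l hl 1 1 (by simp) rfl
      rwa [mul_one] at this)
  have hJ : leftTranslate u.val F ∈ jetIdeal Γ := fun l hl => by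
    rw [wordDer_leftTranslate, ev_leftTranslate, mul_one]
    exact hflat l hl
  rw [jetIdeal_eq hΓ] at hJ
  -- The function `g ↦ F(u g)` vanishes on `Γ`; its value at `u⁻¹` is `F(1)`.
  have h1 := hJ _ (inv_mem hΓ hu)
  rw [ev_leftTranslate, Units.mul_inv] at h1
  exact ev_one_ratioPoly hr1 h1

end MatPoly

/-! ### Galois descent to rational elements of the Lie algebra -/

namespace MatPoly

open MvPolynomial

variable {n : Type*} [Fintype n] [DecidableEq n] {k : Type*} [Field k]

section Descent

variable {K : Type*} [Field K] [Algebra k K]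

/-- Elements that are linearly independent over the ground field of a Galois extension stay
linearly independent when they are regarded as functions on the Galois group. -/
lemma eq_zero_of_forall_sum_eq_zero [IsGalois k K] {ι : Type*} [Fintype ι] {b c : ι → K}
    (hb : LinearIndependent k b) (h : ∀ σ : K ≃ₐ[k] K, ∑ a, c a * σ (b a) = 0) : c = 0 := by
  classical
  have hinj := hb.injective
  -- Independence of Galois translates is available over the fixed field; the Galois property
  -- identifies that field with `k`.
  let F := FixedPoints.subfield (K ≃ₐ[k] K) K
  have hF : ∀ x : F, ∃ y : k, algebraMap k K y = x := fun x =>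
    (InfiniteGalois.mem_range_algebraMap_iff_fixed (k := k) (K := K) (x : K)).2 x.2
  choose f hf using hF
  have hbF : LinearIndependent F b := by
    rw [Fintype.linearIndependent_iff] at hb ⊢
    intro g hg i
    have := hb (fun i => f (g i)) (by
      rw [← hg]
      refine Finset.sum_congr rfl fun i _ => ?_
      rw [Algebra.smul_def, hf]
      rfl) i
    apply Subtype.ext
    rw [← hf, this, map_zero]
    rfl
  have h1 : LinearIndepOn F id ((Finset.univ.image b : Finset K) : Set K) := by
    rw [Finset.coe_image, Finset.coe_univ, Set.image_univ]
    exact hbF.linearIndepOn_id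
  have h2 := FixedPoints.linearIndependent_smul_of_linearIndependent (K ≃ₐ[k] K) K h1
  have h3 : LinearIndependent K (fun a => MulAction.toFun (K ≃ₐ[k] K) K (b a)) := by
    rw [LinearIndepOn, Finset.coe_image, Finset.coe_univ, Set.image_univ] at h2
    exact h2.comp (fun a => (⟨b a, a, rfl⟩ : Set.range b))
      (fun a a' e => hinj (congrArg Subtype.val e))
  rw [Fintype.linearIndependent_iff] at h3
  refine funext fun a => h3 c (funext fun σ => ?_) a
  rw [Finset.sum_apply]
  exact h σ

omit [DecidableEq n] in
/-- Galois descent for subspaces of spaces of matrices. -/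
lemma mem_span_of_galois_stable [IsGalois k K] (W : Submodule K (Matrix n n K))
    (hW : ∀ σ : K ≃ₐ[k] K, ∀ x ∈ W, x.map σ ∈ W) {w : Matrix n n K} (hw : w ∈ W) :
    w ∈ Submodule.span K
      {x | x ∈ W ∧ ∃ v : Matrix n n k, v.map (algebraMap k K) = x} := by
  -- Expanding the entries of `w` in a `k`-basis of their span gives `w = ∑ b_a v_a` with rational
  -- matrices `v_a`. A functional that kills `W` kills every `∑ σ(b_a) v_a`, hence each `v_a`.
  let S : Submodule k K := Submodule.span k (Set.range fun ij : n × n => w ij.1 ij.2)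
  have : Module.Finite k S := Module.Finite.span_of_finite k (Set.finite_range _)
  let b := Module.finBasis k S
  let v : Fin (Module.finrank k S) → Matrix n n k := fun a => Matrix.of fun i j =>
    b.repr ⟨w i j, Submodule.subset_span ⟨(i, j), rfl⟩⟩ a
  have hwv : ∀ σ : K ≃ₐ[k] K, w.map σ = ∑ a, σ (b a : K) • (v a).map (algebraMap k K) := by
    intro σ
    ext i j
    have h1 := congrArg Subtype.val
      (b.sum_repr ⟨w i j, Submodule.subset_span ⟨(i, j), rfl⟩⟩)
    rw [Submodule.coe_sum] at h1
    rw [Matrix.map_apply, Matrix.sum_apply]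
    refine (congrArg σ h1.symm).trans ?_
    rw [map_sum]
    refine Finset.sum_congr rfl fun a _ => ?_
    rw [Submodule.coe_smul, map_smul, Algebra.smul_def, mul_comm]
    rfl
  have hbi : LinearIndependent k (fun a => (b a : K)) :=
    b.linearIndependent.map' S.subtype (Submodule.ker_subtype S)
  have hv : ∀ a, (v a).map (algebraMap k K) ∈ W := by
    intro a
    rw [← Subspace.forall_mem_dualAnnihilator_apply_eq_zero_iff]
    intro φ hφ
    rw [Submodule.mem_dualAnnihilator] at hφ
    have := eq_zero_of_forall_sum_eq_zero (c := fun a => φ ((v a).map (algebraMap k K))) hbi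
      (fun σ => by
        have h1 := hφ _ (hW σ w hw)
        rw [hwv, map_sum] at h1
        rw [← h1]
        exact Finset.sum_congr rfl fun a _ => by rw [map_smul, smul_eq_mul, mul_comm])
    exact congrFun this a
  have hw1 : w = ∑ a, (b a : K) • (v a).map (algebraMap k K) := by
    refine Eq.trans ?_ (hwv 1)
    ext i j
    rfl
  rw [hw1]
  exact Submodule.sum_mem _ fun a _ => Submodule.smul_mem _ _
    (Submodule.subset_span ⟨hv a, v a, rfl⟩)

omit [Fintype n] [DecidableEq n] in
lemma ev_map_map (σ : K →+* K) (g : Matrix n n K) (p : MvPolynomial (n × n) K) :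
    ev (g.map σ) (MvPolynomial.map σ p) = σ (ev g p) := by
  induction p using MvPolynomial.induction_on with
  | C a => simp
  | add p q hp hq => simp [hp, hq]
  | mul_X p ij hp => simp [hp]

lemma diffOne_map (σ : K →+* K) (x : Matrix n n K) (p : MvPolynomial (n × n) K) :
    diffOne (MvPolynomial.map σ p) (x.map σ) = σ (diffOne p x) := by
  have h1 : ∀ p : MvPolynomial (n × n) K, ev (1 : Matrix n n K) (MvPolynomial.map σ p) =
      σ (ev 1 p) := fun p => by
    rw [← ev_map_map, Matrix.map_one _ (map_zero σ) (map_one σ)]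
  induction p using MvPolynomial.induction_on with
  | C a => simp [diffOne_C]
  | add p q hp hq => simp [hp, hq]
  | mul_X p ij hp => 
    have h2 := h1 (X ij)
    rw [map_X] at h2
    rw [map_mul, map_X, diffOne_mul, diffOne_mul, hp, h1, map_add, map_mul, map_mul, diffOne_X,
      diffOne_X, Matrix.map_apply, ← h2]

lemma map_mem_tangent {Γ : Set (Matrix n n K)} (hgal : ∀ σ : K ≃ₐ[k] K, ∀ g ∈ Γ, g.map σ ∈ Γ)
    (σ : K ≃ₐ[k] K) {x : Matrix n n K} (hx : x ∈ tangent Γ) : x.map σ ∈ tangent Γ := by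
  intro p hp
  have hp' : MvPolynomial.map (σ.symm : K →+* K) p ∈ vanishingIdeal Γ := fun g hg => by
    have h1 := ev_map_map (σ.symm : K →+* K) (g.map σ) p
    rw [hp _ (hgal σ g hg), map_zero] at h1
    convert h1 using 2
    ext ij : 2
    simp
  have h2 := diffOne_map (σ : K →+* K) x (MvPolynomial.map (σ.symm : K →+* K) p)
  rw [hx _ hp', map_zero, MvPolynomial.map_map] at h2
  have h3 : (σ : K →+* K).comp (σ.symm : K →+* K) = RingHom.id K := by ext; simp
  rw [h3, MvPolynomial.map_id] at h2
  exact h2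

end Descent

/-- The Lie algebra of a connected group that is defined over `k` contains `k`-rational elements
with simple spectrum in the centralizer of a given `k`-rational element with simple spectrum. -/
theorem exists_rational_diagCoord_injective [CharZero k] {K : Type*} [Field K] [Algebra k K]
    [IsGalois k K] {Γ : Set (Matrix n n K)} (hΓ : IsConnectedGroup Γ)
    (hgal : ∀ σ : K ≃ₐ[k] K, ∀ g ∈ Γ, g.map σ ∈ Γ) {u : (Matrix n n k)ˣ}
    (hu : u.val.map (algebraMap k K) ∈ Γ) {P : (Matrix n n K)ˣ} {μ : n → K}
    (hμ : Function.Injective μ)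
    (hP : u.val.map (algebraMap k K) * P.val = P.val * Matrix.diagonal μ) :
    ∃ c : Matrix n n k, c.map (algebraMap k K) ∈ tangent Γ ∧ c * u.val = u.val * c ∧
      Function.Injective fun i => diagCoord P i (c.map (algebraMap k K)) := by
  have : CharZero K := charZero_of_injective_algebraMap (algebraMap k K).injective
  let uK : (Matrix n n K)ˣ := Units.map (algebraMap k K).mapMatrix.toMonoidHom u
  have huK : uK.val = u.val.map (algebraMap k K) := rfl
  let W : Submodule K (Matrix n n K) := tangent Γ ⊓
    { carrier := {x | x * uK.val = uK.val * x}
      zero_mem' := by simp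
      add_mem' := fun {a b} ha hb => by
        rw [Set.mem_ofPred_eq] at *
        rw [add_mul, mul_add, ha, hb]
      smul_mem' := fun c x hx => by
        rw [Set.mem_ofPred_eq] at *
        rw [smul_mul_assoc, mul_smul_comm, hx] }
  have hW : ∀ σ : K ≃ₐ[k] K, ∀ x ∈ W, x.map σ ∈ W := by
    rintro σ x ⟨hx1, hx2⟩
    refine ⟨map_mem_tangent hgal σ hx1, ?_⟩
    have huσ : uK.val.map σ = uK.val := by
      ext i j
      simp [huK]
    have h3 := congrArg (fun m : Matrix n n K => m.map σ) (show x * uK.val = uK.val * x from hx2)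
    rw [Matrix.map_mul, Matrix.map_mul, huσ] at h3
    exact h3
  let C : Submodule k (Matrix n n k) :=
    (W.restrictScalars k).comap (Algebra.linearMap k K).mapMatrix
  have hC : ∀ c : Matrix n n k, c ∈ C ↔ c.map (algebraMap k K) ∈ W := fun c => Iff.rfl
  by_contra! H
  -- Were there no such `c`, these finitely many subspaces would cover `C`, so one of them would be
  -- all of `C`. Then two weights would agree on the rational elements, hence on their span `W`.
  let L : {ij : n × n // ij.1 ≠ ij.2} → Submodule k C := fun ij =>
    { carrier := {c | diagCoord P ij.1.1 (c.1.map (algebraMap k K)) =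
        diagCoord P ij.1.2 (c.1.map (algebraMap k K))}
      zero_mem' := by simp
      add_mem' := fun {a b} ha hb => by
        rw [Set.mem_ofPred_eq] at *
        rw [Submodule.coe_add, Matrix.map_add _ (map_add _), map_add, map_add, ha, hb]
      smul_mem' := fun c x hx => by
        rw [Set.mem_ofPred_eq] at *
        have : (c • x : C).1.map (algebraMap k K) =
            (algebraMap k K c) • x.1.map (algebraMap k K) := by
          ext i j
          simp
        rw [this, map_smul, map_smul, hx] }
  have hcov : ⋃ ij, (L ij : Set C) = Set.univ := by
    rw [Set.eq_univ_iff_forall]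
    intro c
    have hcW := (hC c.1).1 c.2
    have hcu : c.1 * u.val = u.val * c.1 := by
      have h1 : c.1.map (algebraMap k K) * uK.val = uK.val * c.1.map (algebraMap k K) := hcW.2
      rw [huK, ← Matrix.map_mul, ← Matrix.map_mul] at h1
      exact Matrix.map_injective (algebraMap k K).injective h1
    have h2 := H c.1 hcW.1 hcu
    rw [Function.Injective] at h2
    push Not at h2
    obtain ⟨i, j, h3, h4⟩ := h2
    exact Set.mem_iUnion.2 ⟨⟨(i, j), h4⟩, h3⟩
  obtain ⟨⟨⟨i, j⟩, hij⟩, htop⟩ := Subspace.exists_eq_top_of_iUnion_eq_univ hcov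
  obtain ⟨c, hc1, hc2, hc3⟩ := exists_diagCoord_ne hΓ (u := uK) hu hμ hP hij
  refine hc3 ?_
  have hmem := mem_span_of_galois_stable (k := k) W hW (w := c) ⟨hc1, hc2⟩
  refine Submodule.span_induction ?_ (by simp) ?_ ?_ hmem
  · rintro x ⟨hx, v, rfl⟩
    have : (⟨v, (hC v).2 hx⟩ : C) ∈ L ⟨(i, j), hij⟩ := htop ▸ Submodule.mem_top
    exact this
  · intro x y _ _ hx hy
    rw [map_add, map_add, hx, hy]
  · intro a x _ hx
    rw [map_smul, map_smul, hx]

end MatPoly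

/-! ### The exponential curve in the group of rational points -/

namespace MatPoly

open MvPolynomial Filter

section Exp

variable {ℓ : ℕ} [Fact ℓ.Prime]

/-- Legendre's formula: `(ℓ - 1) v(m!)` is `m` minus the sum of the `ℓ`-adic digits of `m`. -/
lemma norm_inv_factorial_le (m : ℕ) : ‖((m.factorial : ℚ_[ℓ]))⁻¹‖ ≤ (ℓ : ℝ) ^ m := by
  have hp : ℓ.Prime := Fact.out
  have h0 : (m.factorial : ℚ_[ℓ]) ≠ 0 := by exact_mod_cast m.factorial_ne_zero
  rw [norm_inv, Padic.norm_eq_zpow_neg_valuation h0, Padic.valuation_natCast, zpow_neg, inv_inv,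
    zpow_natCast]
  refine pow_le_pow_right₀ (by exact_mod_cast hp.one_le) ?_
  have h1 := sub_one_mul_padicValNat_factorial (p := ℓ) m
  have h2 : 1 ≤ ℓ - 1 := Nat.le_sub_of_add_le hp.two_le
  calc padicValNat ℓ m.factorial ≤ (ℓ - 1) * padicValNat ℓ m.factorial :=
        Nat.le_mul_of_pos_left _ h2
    _ ≤ m := h1.le.trans (Nat.sub_le _ _)

/-- The `ℓ`-adic exponential series has a positive radius of convergence. -/
lemma padic_expSeries_radius_pos (A : Type*) [NormedRing A] [NormedAlgebra ℚ_[ℓ] A] :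
    0 < (NormedSpace.expSeries ℚ_[ℓ] A).radius := by
  have hp : ℓ.Prime := Fact.out
  have hℓ : (0 : ℝ) < ℓ := by exact_mod_cast hp.pos
  let r : NNReal := (ℓ : NNReal)⁻¹
  have hr : 0 < r := inv_pos.2 (by exact_mod_cast hp.pos)
  refine lt_of_lt_of_le (by exact_mod_cast hr)
    ((NormedSpace.expSeries ℚ_[ℓ] A).le_radius_of_bound (max 1 ‖(1 : A)‖) (r := r) fun m => ?_)
  have h1 : ‖NormedSpace.expSeries ℚ_[ℓ] A m‖ ≤ (ℓ : ℝ) ^ m * max 1 ‖(1 : A)‖ := by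
    rw [NormedSpace.expSeries]
    refine (norm_smul_le ((m.factorial : ℚ_[ℓ]))⁻¹
      (ContinuousMultilinearMap.mkPiAlgebraFin ℚ_[ℓ] m A)).trans ?_
    exact mul_le_mul (norm_inv_factorial_le m) ContinuousMultilinearMap.norm_mkPiAlgebraFin_le
      (norm_nonneg _) (by positivity)
  calc ‖NormedSpace.expSeries ℚ_[ℓ] A m‖ * (r : ℝ) ^ m
      ≤ (ℓ : ℝ) ^ m * max 1 ‖(1 : A)‖ * (r : ℝ) ^ m :=
        mul_le_mul_of_nonneg_right h1 (by positivity)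
    _ = max 1 ‖(1 : A)‖ := by
        simp only [r, NNReal.coe_inv, NNReal.coe_natCast]
        rw [mul_right_comm, ← mul_pow, mul_inv_cancel₀ hℓ.ne', one_pow, one_mul]

end Exp

variable {n : Type*} [Fintype n] [DecidableEq n]

section Curve

variable {k : Type*} [NontriviallyNormedField k] [CompleteSpace k] {A : Type*} [NormedRing A]
  [NormedAlgebra k A] [FiniteDimensional k A] (φ : A ≃ₐ[k] Matrix n n k)

/-- A matrix entry of a coordinate isomorphism, as a continuous linear function. -/
def entryCLM (ij : n × n) : A →L[k] k :=
  LinearMap.toContinuousLinearMap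
    ((Matrix.entryLinearMap k k ij.1 ij.2).comp φ.toLinearEquiv.toLinearMap)

lemma entryCLM_apply (ij : n × n) (a : A) : entryCLM φ ij a = φ a ij.1 ij.2 := rfl

lemma hasDerivAt_ev {e : k → A} {c : A} {t : k}
    (he : HasDerivAt e (e t * c) t) (p : MvPolynomial (n × n) k) :
    HasDerivAt (fun s => ev (φ (e s)) p) (ev (φ (e t)) (rightDer (φ c) p)) t := by
  have hent : ∀ ij : n × n, HasDerivAt (fun s => φ (e s) ij.1 ij.2)
      ((φ (e t) * φ c) ij.1 ij.2) t := fun ij => by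
    have h := (entryCLM φ ij).hasFDerivAt.comp_hasDerivAt t he
    rw [entryCLM_apply, map_mul] at h
    exact h
  induction p using MvPolynomial.induction_on with
  | C a =>
    simp only [← MvPolynomial.algebraMap_eq, Derivation.map_algebraMap, map_zero,
      AlgHom.commutes]
    exact hasDerivAt_const _ _
  | add p q hp hq =>
    simp only [map_add]
    exact hp.add hq
  | mul_X p ij hp =>
    have h := hp.mul (hent ij)
    simp only [map_mul, Derivation.leibniz, smul_eq_mul, map_add, ev_X, ev_rightDer_X]
    rw [add_comm, mul_comm (φ (e t) ij.1 ij.2)]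
    exact h

lemma analyticAt_ev {e : k → A} {t : k} (he : AnalyticAt k e t)
    (p : MvPolynomial (n × n) k) : AnalyticAt k (fun s => ev (φ (e s)) p) t := by
  have hent : ∀ ij : n × n, AnalyticAt k (fun s => φ (e s) ij.1 ij.2) t := fun ij =>
    ((entryCLM φ ij).analyticAt (e t)).comp he
  induction p using MvPolynomial.induction_on with
  | C a =>
    simp only [← MvPolynomial.algebraMap_eq, AlgHom.commutes]
    exact analyticAt_const
  | add p q hp hq =>
    simp only [map_add]
    exact hp.add hq
  | mul_X p ij hp =>
    simp only [map_mul, ev_X]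
    exact hp.mul (hent ij)

/-- The `m`-th derivative of `p` along the integral curve `e` is the derivative along the word `c ⋯
c` of length `m`. All of these vanish at 0, so the Taylor series of the analytic function `p ∘ e` is
zero. -/
lemma ev_eventually_eq_zero [CharZero k] {e : k → A}
    {c : A} (hanal : AnalyticAt k e 0) (h0 : e 0 = 1)
    (he : ∀ᶠ t in 𝓝 0, HasDerivAt e (e t * c) t) {p : MvPolynomial (n × n) k}
    (hp : ∀ m : ℕ, ev (1 : Matrix n n k) (wordDer (List.replicate m (φ c)) p) = 0) :
    ∀ᶠ t in 𝓝 0, ev (φ (e t)) p = 0 := by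
  have hder : ∀ m : ℕ, iteratedDeriv m (fun s => ev (φ (e s)) p) =ᶠ[𝓝 0]
      fun s => ev (φ (e s)) (wordDer (List.replicate m (φ c)) p) := by
    intro m
    induction m with
    | zero => simp
    | succ m ih =>
      rw [iteratedDeriv_succ]
      refine ih.deriv.trans ?_
      filter_upwards [he] with t ht
      rw [List.replicate_succ, wordDer_cons]
      exact (hasDerivAt_ev φ ht _).deriv
  have h1 := (analyticAt_ev φ hanal p).hasFPowerSeriesAt
  have h2 : (FormalMultilinearSeries.ofScalars k
      (fun m ↦ iteratedDeriv m (fun s => ev (φ (e s)) p) 0 / m.factorial)) = 0 := by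
    have : (fun m ↦ iteratedDeriv m (fun s => ev (φ (e s)) p) 0 / (m.factorial : k)) = 0 := by
      funext m
      rw [(hder m).eq_of_nhds, h0, map_one, hp, zero_div]
      rfl
    rw [this, FormalMultilinearSeries.ofScalars_series_eq_zero_of_scalar_zero]
  rw [h2] at h1
  exact h1.eventually_eq_zero

end Curve

section PadicCurve

variable {ℓ : ℕ} [Fact ℓ.Prime] {A : Type*} [NormedRing A] [NormedAlgebra ℚ_[ℓ] A]
  [FiniteDimensional ℚ_[ℓ] A] (φ : A ≃ₐ[ℚ_[ℓ]] Matrix n n ℚ_[ℓ])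

/-- Integration of tangent vectors: near the identity, the zero locus of an ideal contains a curve
with the given tangent vector, as soon as the ideal vanishes to infinite order along it. -/
theorem exists_mem_zeroLocus {I : Ideal (MvPolynomial (n × n) ℚ_[ℓ])} {c : A}
    (hI : ∀ p ∈ I, ∀ m : ℕ, ev (1 : Matrix n n ℚ_[ℓ]) (wordDer (List.replicate m (φ c)) p) = 0)
    {N N' : Set A} (hN : N ∈ 𝓝 1) (hN' : N' ∈ 𝓝 c) :
    ∃ t : ℚ_[ℓ], t ≠ 0 ∧ ∃ y ∈ N', y * c = c * y ∧ 1 + t • y ∈ N ∧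
      ∀ p ∈ I, ev (φ (1 + t • y)) p = 0 := by
  have : CompleteSpace A := FiniteDimensional.complete ℚ_[ℓ] A
  have hrad := padic_expSeries_radius_pos (ℓ := ℓ) A
  let e : ℚ_[ℓ] → A := fun t => NormedSpace.exp (t • c)
  have hcont : ContinuousAt (fun t : ℚ_[ℓ] => t • c) 0 :=
    (continuous_id.smul continuous_const).continuousAt
  have h0 : e 0 = 1 := by
    simp only [e, zero_smul, NormedSpace.exp_zero]
  have hder : ∀ᶠ t in 𝓝 (0 : ℚ_[ℓ]), HasDerivAt e (e t * c) t := by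
    have : ∀ᶠ t in 𝓝 (0 : ℚ_[ℓ]), t • c ∈ Metric.eball (0 : A)
        (NormedSpace.expSeries ℚ_[ℓ] A).radius := by
      apply hcont.eventually_mem
      rw [zero_smul]
      exact Metric.eball_mem_nhds _ hrad
    filter_upwards [this] with t ht
    exact hasDerivAt_exp_smul_const_of_mem_ball c t ht
  have hanal : AnalyticAt ℚ_[ℓ] e 0 := by
    have h1 : AnalyticAt ℚ_[ℓ] (NormedSpace.exp : A → A) 0 :=
      (NormedSpace.hasFPowerSeriesAt_exp_zero_of_radius_pos hrad).analyticAt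
    have h2 : AnalyticAt ℚ_[ℓ] (fun t : ℚ_[ℓ] => t • c) 0 := analyticAt_id.smul analyticAt_const
    rw [← zero_smul ℚ_[ℓ] c] at h1
    exact h1.comp (f := fun t : ℚ_[ℓ] => t • c) h2
  -- Finitely many generators allow one neighbourhood of 0 for all of `I`.
  obtain ⟨s, hs⟩ := (isNoetherianRing_iff_ideal_fg (MvPolynomial (n × n) ℚ_[ℓ])).1 inferInstance I
  have hzero : ∀ᶠ t in 𝓝 (0 : ℚ_[ℓ]), ∀ p ∈ s, ev (φ (e t)) p = 0 := by
    rw [eventually_all_finset]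
    exact fun p hp => ev_eventually_eq_zero φ hanal h0 hder
      (hI p (hs ▸ Submodule.subset_span hp))
  have hzero' : ∀ᶠ t in 𝓝 (0 : ℚ_[ℓ]), ∀ p ∈ I, ev (φ (e t)) p = 0 := by
    filter_upwards [hzero] with t ht p hp
    rw [← hs] at hp
    have hle : Submodule.span _ (s : Set (MvPolynomial (n × n) ℚ_[ℓ])) ≤
        RingHom.ker (ev (φ (e t))).toRingHom := Ideal.span_le.2 ht
    exact hle hp
  have hd0 : HasDerivAt e c 0 := by
    have := hder.self_of_nhds
    rwa [h0, one_mul] at this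
  have hslope := hasDerivAt_iff_tendsto_slope_zero.1 hd0
  have hN1 : ∀ᶠ t in 𝓝 (0 : ℚ_[ℓ]), e t ∈ N := by
    apply hd0.continuousAt.eventually_mem
    rwa [h0]
  -- The witness `y` is the difference quotient `(exp(tc) - 1) / t`, which tends to `c`.
  have hev : ∀ᶠ t in 𝓝[≠] (0 : ℚ_[ℓ]), t⁻¹ • (e (0 + t) - e 0) ∈ N' ∧ e t ∈ N ∧
      (∀ p ∈ I, ev (φ (e t)) p = 0) ∧ t ≠ 0 :=
    (hslope.eventually_mem hN').and ((hN1.filter_mono nhdsWithin_le_nhds).and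
      ((hzero'.filter_mono nhdsWithin_le_nhds).and eventually_mem_nhdsWithin))
  obtain ⟨t, ht1, ht2, ht3, ht4⟩ := hev.exists
  rw [zero_add, h0] at ht1
  have hte : 1 + t • (t⁻¹ • (e t - 1)) = e t := by
    rw [smul_smul, mul_inv_cancel₀ ht4, one_smul, add_sub_cancel]
  refine ⟨t, ht4, _, ht1, ?_, by rwa [hte], by rwa [hte]⟩
  have hcomm : Commute (e t) c := ((Commute.refl c).smul_left t).exp_left
  rw [smul_mul_assoc, mul_smul_comm, sub_mul, mul_sub, one_mul, mul_one, hcomm.eq]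

end PadicCurve

end MatPoly

/-! ### Centralizers and conjugacy near an element with semisimple `ad` -/

namespace MatPoly

open Filter

section NormedAlgebra

/-- The operator `x ↦ x * u - u * x`. -/
def commutatorMap (k : Type*) [Field k] {A : Type*} [Ring A] [Algebra k A] (u : A) : A →ₗ[k] A :=
  LinearMap.mulRight k u - LinearMap.mulLeft k u

lemma commutatorMap_apply (k : Type*) [Field k] {A : Type*} [Ring A] [Algebra k A] (u x : A) :
    commutatorMap k u x = x * u - u * x := rfl

lemma mem_ker_commutatorMap {k : Type*} [Field k] {A : Type*} [Ring A] [Algebra k A] {u x : A} :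
    x ∈ LinearMap.ker (commutatorMap k u) ↔ x * u = u * x := by
  rw [LinearMap.mem_ker, commutatorMap_apply, sub_eq_zero]

lemma ker_sup_range_commutatorMap (k : Type*) [Field k] {A : Type*} [Ring A] [Algebra k A]
    [FiniteDimensional k A] {u : A}
    (hu : ∀ x : A, (x * u - u * x) * u = u * (x * u - u * x) → x * u = u * x) :
    Disjoint (LinearMap.ker (commutatorMap k u)) (LinearMap.range (commutatorMap k u)) ∧
      LinearMap.ker (commutatorMap k u) ⊔ LinearMap.range (commutatorMap k u) = ⊤ := by
  have hdisj : Disjoint (LinearMap.ker (commutatorMap k u))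
      (LinearMap.range (commutatorMap k u)) := by
    rw [Submodule.disjoint_def]
    rintro _ hy ⟨x, rfl⟩
    rw [mem_ker_commutatorMap] at hy
    rw [← LinearMap.mem_ker, mem_ker_commutatorMap]
    exact hu x hy
  refine ⟨hdisj, Submodule.eq_top_of_disjoint _ _ ?_ hdisj⟩
  rw [add_comm, LinearMap.finrank_range_add_finrank_ker]

/-- An element commuting with `u` and close to `u` has no larger centralizer than `u`. -/
lemma eventually_centralizer_le (k : Type*) [NontriviallyNormedField k] [CompleteSpace k] {A : Type*}
    [NormedRing A] [NormedAlgebra k A] [FiniteDimensional k A] {u : A}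
    (hu : ∀ x : A, (x * u - u * x) * u = u * (x * u - u * x) → x * u = u * x) :
    ∀ᶠ t in 𝓝 u, t * u = u * t → (∀ z, z * u = u * z → z * t = t * z) →
      ∀ z, z * t = t * z → z * u = u * z := by
  obtain ⟨hdisj, htop⟩ := ker_sup_range_commutatorMap k hu
  set R := LinearMap.range (commutatorMap k u)
  obtain ⟨C, hC, hanti⟩ := ((commutatorMap k u).comp R.subtype).exists_antilipschitzWith (by
    rw [LinearMap.ker_eq_bot']
    intro x hx
    exact Subtype.ext (Submodule.disjoint_def.1 hdisj x hx x.2))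
  have hbound : ∀ x ∈ R, ‖x‖ ≤ C * ‖x * u - u * x‖ := fun x hx => by
    have := hanti.le_mul_dist ⟨x, hx⟩ 0
    rw [map_zero, dist_zero_right, dist_zero_right] at this
    exact this
  have hC0 : (0 : ℝ) < C := hC
  -- Write `z = a + r` with `a` commuting with `u` and `r ∈ R`. If `z` commutes with `t`, so does
  -- `r`, and then `[r, u] = [r, u - t]` has norm at most `2 ‖t - u‖ ‖r‖`. The radius `1 / (2C)`
  -- makes this incompatible with `hbound` unless `r = 0`.
  filter_upwards [Metric.ball_mem_nhds u (inv_pos.2 (mul_pos two_pos hC0))] with t ht htu htz z hz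
  obtain ⟨a, ha, r, hr, rfl⟩ := Submodule.mem_sup.1 (htop ▸ Submodule.mem_top : z ∈ _)
  rw [mem_ker_commutatorMap] at ha
  have hat := htz a ha
  have hrt : r * t = t * r := by
    rw [add_mul, mul_add, hat] at hz
    exact add_left_cancel hz
  have h1 : r * u - u * r = r * (u - t) - (u - t) * r := by
    rw [mul_sub, sub_mul, hrt]
    abel
  have h2 : ‖r‖ ≤ C * (2 * ‖t - u‖ * ‖r‖) := by
    refine (hbound r hr).trans (mul_le_mul_of_nonneg_left ?_ hC0.le)
    rw [h1]
    calc ‖r * (u - t) - (u - t) * r‖ ≤ ‖r * (u - t)‖ + ‖(u - t) * r‖ := norm_sub_le _ _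
      _ ≤ ‖r‖ * ‖u - t‖ + ‖u - t‖ * ‖r‖ := add_le_add (norm_mul_le _ _) (norm_mul_le _ _)
      _ = 2 * ‖t - u‖ * ‖r‖ := by rw [norm_sub_rev]; ring
  have h3 : r = 0 := by
    by_contra hne
    have hr0 : 0 < ‖r‖ := norm_pos_iff.2 hne
    have hC2 : (0 : ℝ) < 2 * C := mul_pos two_pos hC0
    have h4 := mul_lt_mul_of_pos_left ht hC2
    rw [mul_inv_cancel₀ hC2.ne', dist_eq_norm] at h4
    have h5 := mul_lt_mul_of_pos_right h4 hr0
    linarith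
  rw [h3, add_zero, ha]

/-- Every element near `u` is conjugate, by an element near the identity, to an element near `u`
that commutes with `u`. -/
lemma eventually_exists_conj (k : Type*) [NontriviallyNormedField k] [CompleteSpace k] {A : Type*}
    [NormedRing A] [NormedAlgebra k A] [FiniteDimensional k A] {u : A}
    (hu : ∀ x : A, (x * u - u * x) * u = u * (x * u - u * x) → x * u = u * x)
    {W W' : Set A} (hW : W ∈ 𝓝 1) (hW' : W' ∈ 𝓝 u) :
    ∀ᶠ v in 𝓝 u, ∃ g : Aˣ, g.val ∈ W ∧ (g⁻¹).val ∈ W ∧ ∃ t ∈ W', t * u = u * t ∧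
      v = g.val * t * (g⁻¹).val := by
  have : CompleteSpace A := FiniteDimensional.complete k A
  let S := LinearMap.ker (commutatorMap k u)
  have : CompleteSpace S := FiniteDimensional.complete k S
  let a : A × S := (0, ⟨u, mem_ker_commutatorMap.2 rfl⟩)
  have h1 : HasStrictFDerivAt (fun p : A × S => 1 + p.1) (ContinuousLinearMap.fst k A S) a :=
    (ContinuousLinearMap.fst k A S).hasStrictFDerivAt.const_add 1
  have h2 : HasStrictFDerivAt (fun p : A × S => (p.2 : A))
      (S.subtypeL.comp (ContinuousLinearMap.snd k A S)) a :=
    (S.subtypeL.comp (ContinuousLinearMap.snd k A S)).hasStrictFDerivAt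
  have ha1 : (1 : A) + a.1 = ((1 : Aˣ) : A) := by simp [a]
  have h3 : HasStrictFDerivAt (fun p : A × S => Ring.inverse (1 + p.1))
      (-ContinuousLinearMap.fst k A S) a := by
    have h := hasStrictFDerivAt_ringInverse (𝕜 := k) (1 : Aˣ)
    rw [← ha1] at h
    refine (h.comp a h1).congr_fderiv ?_
    ext p <;> simp
  have h4 := (h1.mul' h2).mul' h3
  -- The derivative at `(0, u)` is `(y, c) ↦ y u - u y + c`, surjective because the kernel and the
  -- range of `ad u` span.
  have hmap := h4.map_nhds_eq_of_surj (by
    rw [eq_top_iff]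
    rintro z -
    obtain ⟨c, hc, _, ⟨y, rfl⟩, rfl⟩ := Submodule.mem_sup.1
      ((ker_sup_range_commutatorMap k hu).2 ▸ Submodule.mem_top : z ∈ _)
    refine ⟨(y, ⟨c, hc⟩), ?_⟩
    simp [a, commutatorMap_apply]
    abel)
  have hfa : (1 + a.1) * (a.2 : A) * Ring.inverse (1 + a.1) = u := by simp [a]
  rw [Pi.mul_apply, Pi.mul_apply, hfa] at hmap
  have hnear : ∀ᶠ p in 𝓝 a, IsUnit (1 + p.1) ∧ 1 + p.1 ∈ W ∧ Ring.inverse (1 + p.1) ∈ W ∧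
      (p.2 : A) ∈ W' := by
    have c1 := h1.continuousAt
    have c2 := h2.continuousAt
    have c3 := h3.continuousAt
    refine Filter.Eventually.and (c1.eventually_mem (s := {x | IsUnit x}) ?_) (Filter.Eventually.and
      (c1.eventually_mem ?_) (Filter.Eventually.and (c3.eventually_mem ?_) (c2.eventually_mem ?_)))
    · rw [ha1]
      exact Units.nhds 1
    · simpa [a] using hW
    · simpa [a] using hW
    · exact hW'
  have himage := image_mem_map (m := fun p : A × S => (1 + p.1) * (p.2 : A) *
    Ring.inverse (1 + p.1)) hnear
  change map (fun p : A × S => (1 + p.1) * (p.2 : A) * Ring.inverse (1 + p.1)) (𝓝 a) = _ at hmap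
  rw [hmap] at himage
  filter_upwards [himage]
  rintro v ⟨p, ⟨hp1, hp2, hp3, hp4⟩, rfl⟩
  obtain ⟨g, hg⟩ := hp1
  rw [← hg, Ring.inverse_unit] at hp3
  refine ⟨g, by rwa [hg], hp3, p.2, hp4, mem_ker_commutatorMap.1 p.2.2, ?_⟩
  simp only [← hg, Ring.inverse_unit]

end NormedAlgebra

end MatPoly

/-! ### Matrices with simple spectrum -/

namespace MatPoly

variable {n : Type*} [Fintype n] [DecidableEq n] {k : Type*} [Field k] {K : Type*} [Field K]
  [Algebra k K]

variable (K) in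
/-- A matrix has simple spectrum if it is diagonalizable over the extension `K` with distinct
eigenvalues. -/
def HasSimpleSpectrum (M : Matrix n n k) : Prop :=
  ∃ (P : (Matrix n n K)ˣ) (μ : n → K), Function.Injective μ ∧
    M.map (algebraMap k K) * P.val = P.val * Matrix.diagonal μ

lemma hasSimpleSpectrum_of_nodup [IsAlgClosed K] {M : Matrix n n k}
    (h : (M.charpoly.aroots K).Nodup) : HasSimpleSpectrum K M := by
  set M' := M.map (algebraMap k K) with hM'
  have hc : M.charpoly.aroots K = M'.charpoly.roots := by
    rw [Polynomial.aroots, hM', Matrix.charpoly_map]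
  rw [hc] at h
  classical
  have hcard : Fintype.card M'.charpoly.roots.toFinset = Fintype.card n := by
    rw [Fintype.card_coe, Multiset.toFinset_card_of_nodup h,
      ← (IsAlgClosed.splits M'.charpoly).natDegree_eq_card_roots, Matrix.charpoly_natDegree_eq_dim]
  let e := Fintype.equivOfCardEq hcard.symm
  let μ : n → K := fun i => e i
  have hμ : Function.Injective μ := fun i j hij => e.injective (Subtype.ext hij)
  have hroot : ∀ i, Module.End.HasEigenvalue (Matrix.toLin' M') (μ i) := fun i => by
    rw [Module.End.hasEigenvalue_iff_isRoot_charpoly, ← LinearMap.charpoly_toMatrix (Matrix.toLin' M')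
      (Pi.basisFun K n), LinearMap.toMatrix_eq_toMatrix', LinearMap.toMatrix'_toLin']
    exact Polynomial.isRoot_of_mem_roots (Multiset.mem_toFinset.1 (e i).2)
  choose v hv using fun i => (hroot i).exists_hasEigenvector
  have hli := Module.End.eigenvectors_linearIndependent' _ μ hμ v hv
  let P : Matrix n n K := Matrix.of fun i j => v j i
  have hP : IsUnit P := Matrix.linearIndependent_cols_iff_isUnit.1 hli
  refine ⟨hP.unit, μ, hμ, ?_⟩
  rw [hP.unit_spec]
  ext i j
  rw [Matrix.mul_diagonal]
  have h1 := congrFun (hv j).apply_eq_smul i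
  rw [Matrix.toLin'_apply, Pi.smul_apply, smul_eq_mul, mul_comm] at h1
  exact h1

variable (K) in
-- Up to sign the discriminant is the resultant of `p` and `p'`, which is a combination of `p` and
-- `p'`; if it is a unit, `p` is separable.
lemma nodup_of_discr_ne_zero {p : Polynomial k} (hp : p.Monic) (h : p.discr ≠ 0) :
    (p.aroots K).Nodup := by
  rcases Nat.eq_zero_or_pos p.natDegree with h0 | hpos
  · rw [Polynomial.eq_one_of_monic_natDegree_zero hp h0]
    simp
  have hres := Polynomial.resultant_deriv (Polynomial.natDegree_pos_iff_degree_pos.1 hpos)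
  obtain ⟨a, b, -, -, hab⟩ := Polynomial.exists_mul_add_mul_eq_C_resultant p p.derivative le_rfl
    (Polynomial.natDegree_derivative_le p) (Or.inl hpos.ne')
  have hu : IsUnit (Polynomial.resultant p p.derivative p.natDegree (p.natDegree - 1)) := by
    rw [hres, hp.leadingCoeff, mul_one]
    exact ((isUnit_one.neg).pow _).mul (isUnit_iff_ne_zero.2 h)
  have hsep : p.Separable := by
    obtain ⟨c, hc⟩ := hu.exists_left_inv
    refine ⟨Polynomial.C c * a, Polynomial.C c * b, ?_⟩
    rw [mul_assoc, mul_assoc, ← mul_add, mul_comm a, mul_comm b, hab, ← Polynomial.C_mul, hc,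
      Polynomial.C_1]
  exact Polynomial.nodup_roots hsep.map

lemma HasSimpleSpectrum.smul {M : Matrix n n k} (hM : HasSimpleSpectrum K M) {a : k}
    (ha : a ≠ 0) : HasSimpleSpectrum K (a • M) := by
  obtain ⟨P, μ, hμ, h⟩ := hM
  refine ⟨P, fun i => algebraMap k K a * μ i, fun i j hij => hμ (mul_left_cancel₀
    ((map_ne_zero (algebraMap k K)).2 ha) hij), ?_⟩
  have h1 : (a • M).map (algebraMap k K) = algebraMap k K a • M.map (algebraMap k K) := by
    ext i j
    simp
  have h2 : Matrix.diagonal (fun i => algebraMap k K a * μ i) =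
      algebraMap k K a • Matrix.diagonal μ := by
    rw [← Matrix.diagonal_smul]
    rfl
  rw [h1, h2, smul_mul_assoc, h, mul_smul_comm]

omit [DecidableEq n] in
lemma map_commute_iff {x y : Matrix n n k} :
    x.map (algebraMap k K) * y.map (algebraMap k K) =
      y.map (algebraMap k K) * x.map (algebraMap k K) ↔ x * y = y * x := by
  rw [← Matrix.map_mul, ← Matrix.map_mul]
  exact (Matrix.map_injective (algebraMap k K).injective).eq_iff

lemma HasSimpleSpectrum.commute {M : Matrix n n k} (hM : HasSimpleSpectrum K M)
    {x y : Matrix n n k} (hx : x * M = M * x) (hy : y * M = M * y) : x * y = y * x := by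
  obtain ⟨P, μ, hμ, h⟩ := hM
  rw [← map_commute_iff (K := K)] at hx hy ⊢
  exact commute_of_mul_eq (mul_eq_of_commute hμ h hx) (mul_eq_of_commute hμ h hy)

lemma HasSimpleSpectrum.commute_of_commutator {M : Matrix n n k} (hM : HasSimpleSpectrum K M)
    (x : Matrix n n k) (hx : (x * M - M * x) * M = M * (x * M - M * x)) : x * M = M * x := by
  obtain ⟨P, μ, hμ, h⟩ := hM
  rw [← map_commute_iff (K := K)] at hx ⊢
  refine commute_of_commutator_commute h ?_
  rwa [Matrix.map_sub _ (map_sub _), Matrix.map_mul, Matrix.map_mul] at hx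

/-- A matrix has simple spectrum if every polynomial that kills it also kills a given matrix with
simple spectrum. -/
lemma HasSimpleSpectrum.of_aeval [IsAlgClosed K] {M N : Matrix n n k}
    (hM : HasSimpleSpectrum K M)
    (h : ∀ q : Polynomial k, Polynomial.aeval N q = 0 → Polynomial.aeval M q = 0) :
    HasSimpleSpectrum K N := by
  obtain ⟨P, μ, hμ, hP⟩ := hM
  apply hasSimpleSpectrum_of_nodup
  have h1 := h _ (Matrix.aeval_self_charpoly N)
  set p := N.charpoly with hp
  have hp0 : p.map (algebraMap k K) ≠ 0 := (N.charpoly_monic.map _).ne_zero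
  have hq : ∀ q : Polynomial k, (Polynomial.aeval M q).map (algebraMap k K) * P.val =
      P.val * Matrix.diagonal fun i => Polynomial.aeval (μ i) q := by
    intro q
    induction q using Polynomial.induction_on with
    | C a =>
      have e : (algebraMap k (Matrix n n k) a).map (algebraMap k K) =
          algebraMap K (Matrix n n K) (algebraMap k K a) := by
        rw [Matrix.algebraMap_eq_diagonal, Matrix.algebraMap_eq_diagonal,
          Matrix.diagonal_map (map_zero _)]
        rfl
      simp only [Polynomial.aeval_C]
      rw [e, Algebra.commutes, Matrix.algebraMap_eq_diagonal]
      rfl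
    | add p q hp hq =>
      rw [map_add, Matrix.map_add _ (map_add _), add_mul, hp, hq, ← mul_add, Matrix.diagonal_add]
      simp only [map_add]
    | monomial m a ih =>
      rw [pow_succ, ← mul_assoc, map_mul, Polynomial.aeval_X, Matrix.map_mul, mul_assoc, hP,
        ← mul_assoc, ih, mul_assoc, Matrix.diagonal_mul_diagonal]
      simp only [map_mul, Polynomial.aeval_X]
  -- The characteristic polynomial of `N` kills `M`, so it has the `n` distinct eigenvalues of `M`
  -- as roots. Its degree is `n`, so these are all its roots and they are simple.
  have hroot : ∀ i, μ i ∈ p.aroots K := fun i => by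
    have h2 := hq p
    rw [h1, Matrix.map_zero _ (map_zero _), zero_mul] at h2
    have h3 : Matrix.diagonal (fun i => Polynomial.aeval (μ i) p) = (0 : Matrix n n K) := by
      apply P.isUnit.mul_left_cancel
      rw [← h2, mul_zero]
    rw [Polynomial.mem_aroots']
    refine ⟨hp0, ?_⟩
    have := congrFun (congrFun h3 i) i
    rwa [Matrix.diagonal_apply_eq] at this
  classical
  rw [← Multiset.toFinset_card_eq_card_iff_nodup]
  refine le_antisymm (Multiset.toFinset_card_le _) ?_
  calc (p.aroots K).card ≤ (p.map (algebraMap k K)).natDegree := Polynomial.card_roots' _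
    _ = Fintype.card n := by
        rw [Polynomial.natDegree_map, hp, Matrix.charpoly_natDegree_eq_dim]
    _ = (Finset.univ.image μ).card := by
        rw [Finset.card_image_of_injective _ hμ, Finset.card_univ]
    _ ≤ _ := Finset.card_le_card fun x hx => by
        obtain ⟨i, -, rfl⟩ := Finset.mem_image.1 hx
        exact Multiset.mem_toFinset.2 (hroot i)

/-- Simplicity of the spectrum depends only on the centralizer. -/
lemma HasSimpleSpectrum.of_commute_iff {M N : Matrix n n k} (hM : HasSimpleSpectrum K M)
    (h : ∀ x, x * N = N * x ↔ x * M = M * x) : HasSimpleSpectrum K N := by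
  obtain ⟨P, μ, hμ, hP⟩ := hM
  have hNP := mul_eq_of_commute hμ hP (map_commute_iff.2 ((h N).1 rfl))
  refine ⟨P, _, fun i j hij => ?_, hNP⟩
  set Q := (P⁻¹ : (Matrix n n K)ˣ).val
  have hQ : ∀ {Y : Matrix n n K} {τ : n → K}, Y * P.val = P.val * Matrix.diagonal τ →
      Q * Y = Matrix.diagonal τ * Q := fun {Y τ} hY => by
    apply P.isUnit.mul_right_cancel
    apply P.isUnit.mul_left_cancel
    rw [mul_assoc Q, hY, mul_assoc _ Q, Units.inv_mul, mul_one, ← mul_assoc, ← mul_assoc,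
      Units.mul_inv, one_mul]
  -- If the eigenvalues of `N` at `i` and `j` agree, this matrix unit in the eigenbasis commutes
  -- with `N` but not with `M`. It has entries in `K`; `k`-linear functionals applied entrywise give
  -- matrices over `k`, to which `h` applies.
  set E := P.val * Matrix.single i j (1 : K) * Q with hE
  have hcomm : ∀ {Y : Matrix n n K} {τ : n → K}, Y * P.val = P.val * Matrix.diagonal τ →
      (E * Y = Y * E ↔ τ i = τ j) := fun {Y τ} hY => by
    have e1 : E * Y = P.val * (Matrix.single i j (1 : K) * Matrix.diagonal τ) * Q := by
      rw [hE, mul_assoc _ Q, hQ hY]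
      simp only [mul_assoc]
    have e2 : Y * E = P.val * (Matrix.diagonal τ * Matrix.single i j (1 : K)) * Q := by
      rw [hE, ← mul_assoc, ← mul_assoc, hY]
      simp only [mul_assoc]
    rw [e1, e2]
    constructor
    · intro he
      have h3 := P.isUnit.mul_left_cancel ((P⁻¹).isUnit.mul_right_cancel he)
      have h4 := congrFun (congrFun h3 i) j
      rw [Matrix.mul_diagonal, Matrix.diagonal_mul, Matrix.single_apply_same, one_mul,
        mul_one] at h4
      exact h4.symm
    · intro ht
      congr 2
      ext a b
      rw [Matrix.mul_diagonal, Matrix.diagonal_mul, Matrix.single_apply]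
      split_ifs with hab
      · rw [← hab.1, ← hab.2, ht, mul_comm]
      · rw [zero_mul, mul_zero]
  have hEN : E * N.map (algebraMap k K) = N.map (algebraMap k K) * E := (hcomm hNP).2 hij
  have hmapE : ∀ (φ : K →ₗ[k] k) (Y : Matrix n n k),
      (E * Y.map (algebraMap k K) = Y.map (algebraMap k K) * E → E.map φ * Y = Y * E.map φ) ∧
      ((E * Y.map (algebraMap k K)).map φ = E.map φ * Y ∧
        (Y.map (algebraMap k K) * E).map φ = Y * E.map φ) := fun φ Y => by
    have e1 : (E * Y.map (algebraMap k K)).map φ = E.map φ * Y := by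
      ext a b
      simp only [Matrix.map_apply, Matrix.mul_apply, map_sum]
      refine Finset.sum_congr rfl fun c _ => ?_
      rw [mul_comm, ← Algebra.smul_def, map_smul, smul_eq_mul, mul_comm]
    have e2 : (Y.map (algebraMap k K) * E).map φ = Y * E.map φ := by
      ext a b
      simp only [Matrix.map_apply, Matrix.mul_apply, map_sum]
      refine Finset.sum_congr rfl fun c _ => ?_
      rw [← Algebra.smul_def, map_smul, smul_eq_mul]
    exact ⟨fun he => by rw [← e1, ← e2, he], e1, e2⟩
  have hEM : E * M.map (algebraMap k K) = M.map (algebraMap k K) * E := by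
    ext a b
    rw [← sub_eq_zero, ← Module.forall_dual_apply_eq_zero_iff k]
    intro φ
    obtain ⟨-, e1, e2⟩ := hmapE φ M
    have e3 := (h _).1 ((hmapE φ N).1 hEN)
    rw [map_sub, sub_eq_zero]
    have := congrFun (congrFun (e1.trans (e3.trans e2.symm)) a) b
    exact this
  exact hμ ((hcomm hP).1 hEM)

end MatPoly

/-! ### Extension of the ground field -/

namespace MatPoly

open MvPolynomial

section Map

variable {n : Type*} [Fintype n] {k K : Type*} [Field k] [Field K] [Algebra k K]

omit [Fintype n] in
lemma ev_map_algebraMap (g : Matrix n n K) (p : MvPolynomial (n × n) k) :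
    ev g (MvPolynomial.map (algebraMap k K) p) = ev g p :=
  MvPolynomial.aeval_map_algebraMap _ _ _

omit [Fintype n] in
lemma ev_map_eq (g : Matrix n n k) (p : MvPolynomial (n × n) k) :
    ev (g.map (algebraMap k K)) p = algebraMap k K (ev g p) := by
  have : (Algebra.ofId k K).comp (ev g) = ev (K := k) (g.map (algebraMap k K)) := by
    ext ij
    simp [Algebra.ofId_apply]
  rw [← this]
  rfl

omit [Fintype n] in
lemma ev_map_algEquiv (σ : K ≃ₐ[k] K) (g : Matrix n n K) (p : MvPolynomial (n × n) k) :
    ev (g.map σ) p = σ (ev g p) := by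
  have : (σ : K →ₐ[k] K).comp (ev g) = ev (K := k) (g.map σ) := by
    ext ij
    simp
  rw [← this]
  rfl

lemma rightDer_map (x : Matrix n n k) (p : MvPolynomial (n × n) k) :
    rightDer (x.map (algebraMap k K)) (MvPolynomial.map (algebraMap k K) p) =
      MvPolynomial.map (algebraMap k K) (rightDer x p) := by
  induction p using MvPolynomial.induction_on with
  | C a => simp [← MvPolynomial.algebraMap_eq]
  | add p q hp hq => simp [hp, hq]
  | mul_X p ij hp =>
    have h1 := rightDer_X (x.map (algebraMap k K)) ij
    simp [hp, Derivation.leibniz, rightDer_X]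

lemma wordDer_map (l : List (Matrix n n k)) (p : MvPolynomial (n × n) k) :
    wordDer (l.map fun x => x.map (algebraMap k K)) (MvPolynomial.map (algebraMap k K) p) =
      MvPolynomial.map (algebraMap k K) (wordDer l p) := by
  induction l with
  | nil => rfl
  | cons x l ih => rw [List.map_cons, wordDer_cons, ih, rightDer_map, wordDer_cons]

/-- The polynomials over the ground field that vanish on `Γ`. -/
def rationalVanishingIdeal (k : Type*) [Field k] [Algebra k K] (Γ : Set (Matrix n n K)) :
    Ideal (MvPolynomial (n × n) k) :=
  (vanishingIdeal Γ).comap (MvPolynomial.map (algebraMap k K))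

variable [DecidableEq n]

lemma ev_wordDer_replicate_eq_zero {Γ : Set (Matrix n n K)} (hΓ : IsConnectedGroup Γ)
    {c : Matrix n n k} (hc : c.map (algebraMap k K) ∈ tangent Γ) {p : MvPolynomial (n × n) k}
    (hp : p ∈ rationalVanishingIdeal k Γ) (m : ℕ) :
    ev (1 : Matrix n n k) (wordDer (List.replicate m c) p) = 0 := by
  apply (algebraMap k K).injective
  rw [map_zero, ← ev_map_eq, Matrix.map_one _ (map_zero _) (map_one _), ← ev_map_algebraMap,
    ← wordDer_map]
  refine vanishingIdeal_le_jetIdeal hΓ hp _ fun x hx => ?_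
  rw [List.map_replicate, List.mem_replicate] at hx
  rw [hx.2]
  exact hc

end Map

end MatPoly

/-! ### Algebraic subgroups as sets of matrices -/

namespace LinearAlgebraicSubgroup

open MatPoly

variable {k : Type*} [Field k] {V : Type*} [AddCommGroup V] [Module k V] {n : Type*} [Fintype n]
  [DecidableEq n] (b : Module.Basis n k V)

/-- The matrix of a geometric point of `GL(V)` with respect to a basis of `V`. -/
def geomMatrix (g : GeomGL k V) : Matrix n n (AlgebraicClosure k) :=
  LinearMap.toMatrixAlgEquiv (Algebra.TensorProduct.basis (AlgebraicClosure k) b) g.val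

lemma matrixCoeff_basis (g : GeomGL k V) (i j : n) :
    matrixCoeff g (b.coord i, b j) = geomMatrix b g i j := by
  rw [geomMatrix, LinearMap.toMatrixAlgEquiv_apply, Algebra.TensorProduct.basis_apply, matrixCoeff]
  generalize g.val (1 ⊗ₜ[k] b j) = w
  induction w using TensorProduct.induction_on with
  | zero => simp
  | tmul a v => simp [Algebra.smul_def, mul_comm]
  | add x y hx hy => rw [map_add, hx, hy, map_add, Finsupp.add_apply]

omit [DecidableEq n] in
lemma baseChange_dual_eq_sum (φ : Module.Dual k V) (w : AlgebraicClosure k ⊗[k] V) :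
    Module.Dual.baseChange (AlgebraicClosure k) φ w =
      ∑ i, φ (b i) • Module.Dual.baseChange (AlgebraicClosure k) (b.coord i) w := by
  induction w using TensorProduct.induction_on with
  | zero => simp
  | tmul a v =>
    have h : φ v = ∑ i, φ (b i) * b.repr v i := by
      conv_lhs => rw [← b.sum_repr v]
      simp only [map_sum, map_smul, smul_eq_mul, mul_comm]
    simp [h, Finset.sum_smul, mul_smul]
  | add x y hx hy => simp only [map_add, hx, hy, smul_add, Finset.sum_add_distrib]

lemma matrixCoeff_eq (g : GeomGL k V) (x : Module.Dual k V × V) :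
    matrixCoeff g x = ∑ ij : n × n,
      algebraMap k (AlgebraicClosure k) (x.1 (b ij.1) * b.repr x.2 ij.2) *
        geomMatrix b g ij.1 ij.2 := by
  have h : (1 : AlgebraicClosure k) ⊗ₜ[k] x.2 = ∑ j, b.repr x.2 j • (1 ⊗ₜ[k] b j) := by
    conv_lhs => rw [← b.sum_repr x.2]
    simp only [TensorProduct.tmul_sum, TensorProduct.tmul_smul]
  have h' (i j : n) : Module.Dual.baseChange (AlgebraicClosure k) (b.coord i)
      (g.val (1 ⊗ₜ[k] b j)) = geomMatrix b g i j := matrixCoeff_basis b g i j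
  rw [matrixCoeff, baseChange_dual_eq_sum b, Fintype.sum_prod_type]
  refine Finset.sum_congr rfl fun i _ => ?_
  rw [h, map_sum, map_sum, Finset.smul_sum]
  refine Finset.sum_congr rfl fun j _ => ?_
  rw [LinearMap.map_smul_of_tower, LinearMap.map_smul_of_tower, h', smul_smul, Algebra.smul_def]

/-- The polynomial in the matrix entries that corresponds to a polynomial in the matrix
coefficients. -/
def toMatPoly : MvPolynomial (Module.Dual k V × V) k →ₐ[k] MvPolynomial (n × n) k :=
  MvPolynomial.aeval fun x => ∑ ij : n × n,
    MvPolynomial.C (x.1 (b ij.1) * b.repr x.2 ij.2) * MvPolynomial.X ij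

lemma ev_toMatPoly (g : GeomGL k V) (p : MvPolynomial (Module.Dual k V × V) k) :
    ev (geomMatrix b g) (toMatPoly b p) = MvPolynomial.aeval (matrixCoeff g) p := by
  have : (ev (geomMatrix b g)).comp (toMatPoly b) =
      MvPolynomial.aeval (R := k) (matrixCoeff g) := by
    ext x
    rw [MvPolynomial.aeval_X, matrixCoeff_eq b, AlgHom.comp_apply, toMatPoly, MvPolynomial.aeval_X,
      map_sum]
    refine Finset.sum_congr rfl fun ij _ => ?_
    rw [map_mul, ev_X, ← MvPolynomial.algebraMap_eq, AlgHom.commutes]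
  exact congrArg (fun f => f p) this

lemma aeval_rename (g : GeomGL k V) (p : MvPolynomial (n × n) (AlgebraicClosure k)) :
    MvPolynomial.aeval (matrixCoeff g)
      (MvPolynomial.rename (fun ij : n × n => (b.coord ij.1, b ij.2)) p) =
        ev (geomMatrix b g) p := by
  rw [MvPolynomial.aeval_rename, ev]
  congr 2
  exact funext fun ij => matrixCoeff_basis b g ij.1 ij.2

lemma geomMatrix_one : geomMatrix b (1 : GeomGL k V) = 1 := map_one _

lemma geomMatrix_mul (g h : GeomGL k V) : geomMatrix b (g * h) = geomMatrix b g * geomMatrix b h :=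
  map_mul _ _ _

lemma exists_geomMatrix_eq {M : Matrix n n (AlgebraicClosure k)} (hM : IsUnit M) :
    ∃ g : GeomGL k V, geomMatrix b g = M := by
  obtain ⟨M, rfl⟩ := hM
  refine ⟨Units.mapEquiv (LinearMap.toMatrixAlgEquiv
    (Algebra.TensorProduct.basis (AlgebraicClosure k) b)).symm.toMulEquiv M, ?_⟩
  exact AlgEquiv.apply_symm_apply _ _

lemma isUnit_geomMatrix (g : GeomGL k V) : IsUnit (geomMatrix b g) :=
  (Units.isUnit g).map (LinearMap.toMatrixAlgEquiv
    (Algebra.TensorProduct.basis (AlgebraicClosure k) b))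

lemma geomMatrix_geomPoint (u : LinearMap.GeneralLinearGroup k V) :
    geomMatrix b (geomPoint u) =
      (LinearMap.toMatrixAlgEquiv b u.val).map (algebraMap k (AlgebraicClosure k)) := by
  ext i j
  have h : (geomPoint u).val (1 ⊗ₜ[k] b j) = 1 ⊗ₜ[k] (u.val (b j)) := rfl
  rw [← matrixCoeff_basis, matrixCoeff, h]
  simp [LinearMap.toMatrixAlgEquiv_apply, Algebra.smul_def]

lemma geomMatrix_injective : Function.Injective (geomMatrix (k := k) b) := fun _ _ hgh =>
  Units.ext ((LinearMap.toMatrixAlgEquiv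
    (Algebra.TensorProduct.basis (AlgebraicClosure k) b)).injective hgh)

lemma isOpen_setOf_exists_ne (A : Set (MvPolynomial (n × n) (AlgebraicClosure k))) :
    IsOpen[zariskiTopologyGL k V] {g | ∃ p ∈ A, ev (geomMatrix b g) p ≠ 0} := by
  let _ := zariskiTopologyGL k V
  have : {g : GeomGL k V | ∃ p ∈ A, ev (geomMatrix b g) p ≠ 0} =
      ⋃ p ∈ A, {g | ev (geomMatrix b g) p ≠ 0} := by
    ext g
    simp
  rw [this]
  refine isOpen_biUnion fun p _ => TopologicalSpace.isOpen_generateFrom_of_mem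
    ⟨MvPolynomial.rename (fun ij : n × n => (b.coord ij.1, b ij.2)) p, ?_⟩
  ext g
  rw [Set.mem_ofPred_eq, Set.mem_ofPred_eq, aeval_rename]

variable [CharZero k] (GG : LinearAlgebraicSubgroup k V)

/-- The matrices of the geometric points of an algebraic subgroup of `GL(V)`. -/
def matrixGroup : Set (Matrix n n (AlgebraicClosure k)) :=
  geomMatrix b '' (GG.geomPoints : Set (GeomGL k V))

lemma geomMatrix_mem {g : GeomGL k V} : geomMatrix b g ∈ matrixGroup b GG ↔ g ∈ GG.geomPoints :=
  ⟨fun ⟨_, hh, e⟩ => geomMatrix_injective b e ▸ hh, fun h => ⟨g, h, rfl⟩⟩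

lemma exists_matrix_equations : ∃ S : Set (MvPolynomial (n × n) k),
    ∀ M : Matrix n n (AlgebraicClosure k), IsUnit M →
      (M ∈ matrixGroup b GG ↔ ∀ p ∈ S, ev M p = 0) := by
  obtain ⟨S, hS⟩ := GG.exists_equations
  refine ⟨toMatPoly b '' S, fun M hM => ?_⟩
  obtain ⟨g, rfl⟩ := exists_geomMatrix_eq b hM
  rw [geomMatrix_mem, Set.forall_mem_image, ← SetLike.mem_coe, hS]
  simp only [ev_toMatPoly]
  rfl

lemma isUnit_of_mem_matrixGroup {M : Matrix n n (AlgebraicClosure k)}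
    (hM : M ∈ matrixGroup b GG) : IsUnit M := by
  obtain ⟨g, -, rfl⟩ := hM
  exact isUnit_geomMatrix b g

lemma isConnectedGroup_matrixGroup (hconn : GG.IsConnectedGroup) :
    MatPoly.IsConnectedGroup (matrixGroup b GG) where
  one_mem := ⟨1, GG.geomPoints.one_mem, geomMatrix_one b⟩
  mul_mem := by
    rintro _ ⟨g, hg, rfl⟩ _ ⟨h, hh, rfl⟩
    exact ⟨g * h, GG.geomPoints.mul_mem hg hh, geomMatrix_mul b g h⟩
  exists_inv := by
    rintro _ ⟨g, hg, rfl⟩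
    refine ⟨_, ⟨g⁻¹, GG.geomPoints.inv_mem hg, rfl⟩, ?_⟩
    rw [← geomMatrix_mul, mul_inv_cancel, geomMatrix_one]
  connected := by
    intro A B hcov ⟨M, hM, hMA⟩ ⟨N, hN, hNB⟩
    obtain ⟨g, hg, rfl⟩ := hM
    obtain ⟨h, hh, rfl⟩ := hN
    let _ := zariskiTopologyGL k V
    obtain ⟨x, hx, hxA, hxB⟩ := hconn.isPreconnected _ _ (isOpen_setOf_exists_ne b A)
      (isOpen_setOf_exists_ne b B) (fun y hy => hcov _ ⟨y, hy, rfl⟩) ⟨g, hg, hMA⟩ ⟨h, hh, hNB⟩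
    exact ⟨_, ⟨x, hx, rfl⟩, hxA, hxB⟩

/-- The defining equations have coefficients in `k`. -/
lemma map_mem_matrixGroup (σ : AlgebraicClosure k ≃ₐ[k] AlgebraicClosure k)
    {M : Matrix n n (AlgebraicClosure k)} (hM : M ∈ matrixGroup b GG) :
    M.map σ ∈ matrixGroup b GG := by
  obtain ⟨S, hS⟩ := exists_matrix_equations b GG
  have hu := isUnit_of_mem_matrixGroup b GG hM
  have hu' : IsUnit (M.map σ) := hu.map (σ : AlgebraicClosure k →+* AlgebraicClosure k).mapMatrix
  rw [hS _ hu']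
  intro p hp
  rw [ev_map_algEquiv, (hS M hu).1 hM p hp, map_zero]

lemma mem_rationalPoints_iff (u : LinearMap.GeneralLinearGroup k V) :
    u ∈ GG.rationalPoints ↔
      (LinearMap.toMatrixAlgEquiv b u.val).map (algebraMap k (AlgebraicClosure k)) ∈
        matrixGroup b GG := by
  rw [← geomMatrix_geomPoint, geomMatrix_mem]
  rfl

/-- The defining equations themselves belong to the rational vanishing ideal. -/
lemma mem_rationalPoints_of_forall (u : LinearMap.GeneralLinearGroup k V)
    (h : ∀ p ∈ rationalVanishingIdeal k (matrixGroup b GG),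
      ev (LinearMap.toMatrixAlgEquiv b u.val) p = 0) : u ∈ GG.rationalPoints := by
  obtain ⟨S, hS⟩ := exists_matrix_equations b GG
  rw [mem_rationalPoints_iff b, hS _ (by
    rw [← geomMatrix_geomPoint]
    exact isUnit_geomMatrix b _)]
  intro p hp
  rw [ev_map_eq, h p, map_zero]
  intro N hN
  rw [ev_map_algebraMap]
  exact (hS N (isUnit_of_mem_matrixGroup b GG hN)).1 hN p hp

end LinearAlgebraicSubgroup

/-! ### Endomorphisms with simple spectrum -/

namespace LinearMap

open MatPoly

section SimpleSpectrum

variable {k : Type*} [Field k] {V : Type*} [AddCommGroup V] [Module k V] {n : Type*} [Fintype n]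
  [DecidableEq n] {b : Module.Basis n k V}

/-- An endomorphism has simple spectrum if its matrix has, over the algebraic closure. -/
def HasSimpleSpectrum (b : Module.Basis n k V) (u : Module.End k V) : Prop :=
  MatPoly.HasSimpleSpectrum (AlgebraicClosure k) (LinearMap.toMatrixAlgEquiv b u)

lemma toMatrixAlgEquiv_commute_iff {x y : Module.End k V} :
    toMatrixAlgEquiv b x * toMatrixAlgEquiv b y = toMatrixAlgEquiv b y * toMatrixAlgEquiv b x ↔
      x * y = y * x := by
  rw [← map_mul, ← map_mul, EmbeddingLike.apply_eq_iff_eq]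

lemma HasSimpleSpectrum.commute {u : Module.End k V} (hu : HasSimpleSpectrum b u)
    {x y : Module.End k V} (hx : x * u = u * x) (hy : y * u = u * y) : x * y = y * x :=
  toMatrixAlgEquiv_commute_iff.1 (MatPoly.HasSimpleSpectrum.commute hu
    (toMatrixAlgEquiv_commute_iff.2 hx) (toMatrixAlgEquiv_commute_iff.2 hy))

lemma HasSimpleSpectrum.commute_of_commutator {u : Module.End k V} (hu : HasSimpleSpectrum b u)
    (x : Module.End k V) (hx : (x * u - u * x) * u = u * (x * u - u * x)) : x * u = u * x := by
  refine toMatrixAlgEquiv_commute_iff.1 (MatPoly.HasSimpleSpectrum.commute_of_commutator hu _ ?_)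
  simpa only [map_mul, map_sub] using congrArg (toMatrixAlgEquiv b) hx

lemma HasSimpleSpectrum.commute_iff {u v : Module.End k V} (hu : HasSimpleSpectrum b u)
    (hv : HasSimpleSpectrum b v) (huv : u * v = v * u) (x : Module.End k V) :
    x * u = u * x ↔ x * v = v * x :=
  ⟨fun h => hu.commute h huv.symm, fun h => hv.commute h huv⟩

lemma HasSimpleSpectrum.smul {u : Module.End k V} (hu : HasSimpleSpectrum b u) {a : k}
    (ha : a ≠ 0) : HasSimpleSpectrum b (a • u) := by
  rw [HasSimpleSpectrum, map_smul]
  exact MatPoly.HasSimpleSpectrum.smul hu ha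

lemma HasSimpleSpectrum.of_aeval {u v : Module.End k V} (hu : HasSimpleSpectrum b u)
    (h : ∀ q : Polynomial k, Polynomial.aeval v q = 0 → Polynomial.aeval u q = 0) :
    HasSimpleSpectrum b v := by
  refine MatPoly.HasSimpleSpectrum.of_aeval hu fun q hq => ?_
  rw [Polynomial.aeval_algHom_apply, EmbeddingLike.map_eq_zero_iff] at hq ⊢
  exact h q hq

lemma HasSimpleSpectrum.of_commute_iff {u v : Module.End k V} (hu : HasSimpleSpectrum b u)
    (h : ∀ x, x * v = v * x ↔ x * u = u * x) : HasSimpleSpectrum b v := by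
  refine MatPoly.HasSimpleSpectrum.of_commute_iff hu fun x => ?_
  obtain ⟨x, rfl⟩ := (toMatrixAlgEquiv b).surjective x
  rw [toMatrixAlgEquiv_commute_iff, toMatrixAlgEquiv_commute_iff, h]

variable [FiniteDimensional k V]

lemma hasSimpleSpectrum_of_nodup {u : Module.End k V}
    (h : (u.charpoly.aroots (AlgebraicClosure k)).Nodup) : HasSimpleSpectrum b u := by
  apply MatPoly.hasSimpleSpectrum_of_nodup
  rwa [← LinearMap.charpoly_toMatrix u b] at h

lemma hasSimpleSpectrum_of_discr_ne_zero {u : Module.End k V} (h : u.charpoly.discr ≠ 0) :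
    HasSimpleSpectrum b u :=
  hasSimpleSpectrum_of_nodup (nodup_of_discr_ne_zero _ u.charpoly_monic h)

end SimpleSpectrum

end LinearMap

/-! ### Lattices and the orders `Z(u)_0` -/

section Order

variable {ℓ : ℕ} [Fact ℓ.Prime] {V : Type*} [AddCommGroup V] [Module ℚ_[ℓ] V]

instance : IsModuleTopology ℚ_[ℓ] (Module.End ℚ_[ℓ] V) := ⟨rfl⟩

instance : ContinuousSMul ℚ_[ℓ] (Module.End ℚ_[ℓ] V) := IsModuleTopology.toContinuousSMul ℚ_[ℓ] _

variable [Module ℤ_[ℓ] V] [IsScalarTower ℤ_[ℓ] ℚ_[ℓ] V] {T : Submodule ℤ_[ℓ] V}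

lemma smul_mem_of_norm_le_one {a : ℚ_[ℓ]} (ha : ‖a‖ ≤ 1) {x : V} (hx : x ∈ T) : a • x ∈ T := by
  let r : ℤ_[ℓ] := ⟨a, ha⟩
  have h : a • x = r • x := algebraMap_smul ℚ_[ℓ] r x
  exact h ▸ T.smul_mem r hx

lemma mem_centralizerOrder {u f : Module.End ℚ_[ℓ] V} :
    f ∈ centralizerOrder T u ↔ f * u = u * f ∧ f ∈ endLattice T := by
  rw [centralizerOrder, Algebra.mem_inf, Subalgebra.mem_centralizer_iff]
  simp [eq_comm]

lemma centralizerOrder_congr {u v : Module.End ℚ_[ℓ] V}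
    (h : ∀ x, x * u = u * x ↔ x * v = v * x) : centralizerOrder T u = centralizerOrder T v := by
  ext f
  rw [mem_centralizerOrder, mem_centralizerOrder, h]

/-- Conjugation by an automorphism of the lattice identifies the orders. -/
lemma nonempty_centralizerOrder_conj {g g' : Module.End ℚ_[ℓ] V} (h : g * g' = 1)
    (h' : g' * g = 1) (hg : g ∈ endLattice T) (hg' : g' ∈ endLattice T)
    (u : Module.End ℚ_[ℓ] V) :
    Nonempty (centralizerOrder T (g * u * g') ≃ₐ[ℤ_[ℓ]] centralizerOrder T u) := by
  have key {p p' v x : Module.End ℚ_[ℓ] V} (hp : p' * p = 1) (hx : x * v = v * x) :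
      p * x * p' * (p * v * p') = p * v * p' * (p * x * p') := by
    calc p * x * p' * (p * v * p') = p * x * (p' * p) * v * p' := by noncomm_ring
      _ = p * (x * v) * p' := by rw [hp]; noncomm_ring
      _ = p * v * (p' * p) * x * p' := by rw [hp, hx]; noncomm_ring
      _ = _ := by noncomm_ring
  have cancel {p p' : Module.End ℚ_[ℓ] V} (hp : p * p' = 1) (x : Module.End ℚ_[ℓ] V) :
      p * (p' * x * p) * p' = x := by
    calc p * (p' * x * p) * p' = (p * p') * x * (p * p') := by noncomm_ring
      _ = x := by rw [hp, one_mul, mul_one]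
  refine ⟨{
    toFun := fun x => ⟨g' * x.1 * g, ?_⟩
    invFun := fun x => ⟨g * x.1 * g', ?_⟩
    left_inv := fun x => Subtype.ext (cancel h x.1)
    right_inv := fun x => Subtype.ext (cancel h' x.1)
    map_mul' := fun x y => Subtype.ext ?_
    map_add' := fun x y => Subtype.ext ?_
    commutes' := fun r => Subtype.ext ?_ }⟩
  · have hx := mem_centralizerOrder.1 x.2
    refine mem_centralizerOrder.2 ⟨?_, mul_mem (mul_mem hg' hx.2) hg⟩
    have := key h hx.1
    rwa [cancel h'] at this
  · have hx := mem_centralizerOrder.1 x.2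
    exact mem_centralizerOrder.2 ⟨key h' hx.1, mul_mem (mul_mem hg hx.2) hg'⟩
  · change g' * (x.1 * y.1) * g = g' * x.1 * g * (g' * y.1 * g)
    calc g' * (x.1 * y.1) * g = g' * x.1 * 1 * y.1 * g := by noncomm_ring
      _ = _ := by rw [← h]; noncomm_ring
  · change g' * (x.1 + y.1) * g = g' * x.1 * g + g' * y.1 * g
    noncomm_ring
  · change g' * algebraMap ℤ_[ℓ] _ r * g = algebraMap ℤ_[ℓ] _ r
    rw [← Algebra.commutes, mul_assoc, h', mul_one]

section Basis

variable {n : Type*} [Fintype n] [DecidableEq n]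

/-- A basis of the ambient space that spans the lattice. -/
def IsLatticeBasis (T : Submodule ℤ_[ℓ] V) (b : Module.Basis n ℚ_[ℓ] V) : Prop :=
  ∀ x, x ∈ T ↔ ∀ i, ‖b.repr x i‖ ≤ 1

lemma exists_isLatticeBasis [Submodule.IsLattice ℚ_[ℓ] T] :
    ∃ b : Module.Basis (Module.Free.ChooseBasisIndex ℤ_[ℓ] T) ℚ_[ℓ] V, IsLatticeBasis T b := by
  let c := Module.Free.chooseBasis ℤ_[ℓ] T
  have hb : ∀ i, c.extendOfIsLattice ℚ_[ℓ] i = (c i).val :=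
    Module.Basis.extendOfIsLattice_apply ℚ_[ℓ] c
  refine ⟨c.extendOfIsLattice ℚ_[ℓ], fun x => ⟨fun hx i => ?_, fun hx => ?_⟩⟩
  · have h : x = ∑ j, ((c.repr ⟨x, hx⟩ j : ℤ_[ℓ]) : ℚ_[ℓ]) • c.extendOfIsLattice ℚ_[ℓ] j := by
      conv_lhs => rw [← Subtype.coe_mk x hx, ← c.sum_repr ⟨x, hx⟩]
      rw [AddSubmonoidClass.coe_finsetSum]
      refine Finset.sum_congr rfl fun j _ => ?_
      rw [hb]
      exact (algebraMap_smul ℚ_[ℓ] (c.repr ⟨x, hx⟩ j) (c j).val).symm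
    rw [h, Module.Basis.repr_sum_self]
    exact PadicInt.norm_le_one _
  · rw [← (c.extendOfIsLattice ℚ_[ℓ]).sum_repr x]
    refine T.sum_mem fun i _ => ?_
    rw [hb]
    exact smul_mem_of_norm_le_one (hx i) (c i).2

variable {b : Module.Basis n ℚ_[ℓ] V}

omit [IsScalarTower ℤ_[ℓ] ℚ_[ℓ] V] [Fintype n] in
lemma IsLatticeBasis.basis_mem (hb : IsLatticeBasis T b) (i : n) : b i ∈ T := by
  rw [hb]
  intro j
  rw [b.repr_self, Finsupp.single_apply]
  split_ifs <;> simp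

lemma IsLatticeBasis.mem_endLattice_iff (hb : IsLatticeBasis T b) {f : Module.End ℚ_[ℓ] V} :
    f ∈ endLattice T ↔ ∀ i j, ‖LinearMap.toMatrixAlgEquiv b f i j‖ ≤ 1 := by
  simp only [LinearMap.toMatrixAlgEquiv_apply]
  refine ⟨fun hf i j => (hb _).1 (hf _ (hb.basis_mem j)) i, fun h x hx => ?_⟩
  rw [← b.sum_repr x, map_sum]
  refine T.sum_mem fun j _ => ?_
  rw [map_smul]
  exact smul_mem_of_norm_le_one ((hb x).1 hx j) ((hb (f (b j))).2 fun i => h i j)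

lemma IsLatticeBasis.isOpen_endLattice (hb : IsLatticeBasis T b) :
    IsOpen (endLattice T : Set (Module.End ℚ_[ℓ] V)) := by
  have : (endLattice T : Set (Module.End ℚ_[ℓ] V)) =
      ⋂ i, ⋂ j, {f | LinearMap.toMatrixAlgEquiv b f i j ∈ Metric.closedBall (0 : ℚ_[ℓ]) 1} := by
    ext f
    simp [hb.mem_endLattice_iff]
  rw [this]
  refine isOpen_iInter_of_finite fun i => isOpen_iInter_of_finite fun j => ?_
  exact (IsUltrametricDist.isOpen_closedBall _ one_ne_zero).preimage
    (IsModuleTopology.continuous_of_linearMap ((Matrix.entryLinearMap ℚ_[ℓ] ℚ_[ℓ] i j).comp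
      (LinearMap.toMatrixAlgEquiv b).toLinearEquiv.toLinearMap))

lemma IsLatticeBasis.exists_smul_mem (hb : IsLatticeBasis T b) (f : Module.End ℚ_[ℓ] V) :
    ∃ a : ℚ_[ℓ], a ≠ 0 ∧ a • f ∈ endLattice T := by
  have hc : Filter.Tendsto (fun a : ℚ_[ℓ] => a • f) (𝓝[≠] 0) (𝓝 0) := by
    have : Filter.Tendsto (fun a : ℚ_[ℓ] => a • f) (𝓝 0) (𝓝 ((0 : ℚ_[ℓ]) • f)) :=
      (continuous_id.smul continuous_const).tendsto 0
    rw [zero_smul] at this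
    exact this.mono_left nhdsWithin_le_nhds
  have h := hc.eventually (hb.isOpen_endLattice.mem_nhds (zero_mem (endLattice T)))
  obtain ⟨a, ha, ha0⟩ := (h.and self_mem_nhdsWithin).exists
  exact ⟨a, ha0, ha⟩

/-- Two opposite matrix units witness this; it excludes the identity from the locus when `d ≥ 2`. -/
lemma IsLatticeBasis.not_commute [Nontrivial n] (hb : IsLatticeBasis T b) :
    ∃ f ∈ endLattice T, ∃ g ∈ endLattice T, f * g ≠ g * f := by
  obtain ⟨i, j, hij⟩ := exists_pair_ne n
  have hmem (p q : n) : (LinearMap.toMatrixAlgEquiv b).symm (Matrix.single p q 1) ∈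
      endLattice T := by
    rw [hb.mem_endLattice_iff, AlgEquiv.apply_symm_apply]
    intro r s
    rw [Matrix.single_apply]
    split_ifs <;> simp
  refine ⟨_, hmem i j, _, hmem j i, fun h => ?_⟩
  rw [← map_mul, ← map_mul, EmbeddingLike.apply_eq_iff_eq, Matrix.single_mul_single_same,
    Matrix.single_mul_single_same] at h
  have := congrFun (congrFun h i) i
  simp [hij.symm] at this

/-- An endomorphism has simple spectrum if its order is isomorphic to that of an endomorphism with
simple spectrum. -/
lemma IsLatticeBasis.hasSimpleSpectrum_of_equiv (hb : IsLatticeBasis T b)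
    {u v : Module.End ℚ_[ℓ] V} (hv : LinearMap.HasSimpleSpectrum b v)
    (ψ : centralizerOrder T u ≃ₐ[ℤ_[ℓ]] centralizerOrder T v) :
    LinearMap.HasSimpleSpectrum b u := by
  obtain ⟨a, ha, hav⟩ := hb.exists_smul_mem v
  let v' : centralizerOrder T v := ⟨a • v, mem_centralizerOrder.2 ⟨by simp, hav⟩⟩
  -- A multiple of `v` lies in its order; its preimage `w` satisfies no polynomial equation that
  -- this multiple does not satisfy, so `w` has simple spectrum. The order of `u` is commutative and
  -- contains `w`, which gives `Z(u) = Z(w)`.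
  let w := ψ.symm v'
  have hw : LinearMap.HasSimpleSpectrum b w.1 := by
    refine (hv.smul ha).of_aeval fun q hq => ?_
    -- The map `ψ` is only `ℤ_ℓ`-linear, so denominators are cleared first.
    obtain ⟨c, hc, hcq⟩ := IsLocalization.integerNormalization_spec (nonZeroDivisors ℤ_[ℓ]) q
    set p := IsLocalization.integerNormalization (nonZeroDivisors ℤ_[ℓ]) q
    have hp (f : Module.End ℚ_[ℓ] V) :
        Polynomial.aeval f p = algebraMap ℤ_[ℓ] ℚ_[ℓ] c • Polynomial.aeval f q := by
      rw [← Polynomial.aeval_map_algebraMap ℚ_[ℓ], hcq, ← algebraMap_smul ℚ_[ℓ] c q, map_smul]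
    have hcoe (S : Subalgebra ℤ_[ℓ] (Module.End ℚ_[ℓ] V)) (x : S) :
        (Polynomial.aeval x p).1 = Polynomial.aeval x.1 p :=
      (Polynomial.aeval_algHom_apply S.val x p).symm
    have hwp : Polynomial.aeval w p = 0 := by
      apply Subtype.ext
      rw [hcoe, hp, hq, smul_zero]
      rfl
    have hvp : Polynomial.aeval v' p = 0 := by
      have := congrArg ψ hwp
      rwa [map_zero, ← Polynomial.aeval_algHom_apply, AlgEquiv.apply_symm_apply] at this
    have h := congrArg Subtype.val hvp
    rw [hcoe, hp] at h
    exact (smul_eq_zero.1 h).resolve_left fun h0 => nonZeroDivisors.ne_zero hc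
      (IsFractionRing.injective ℤ_[ℓ] ℚ_[ℓ] (h0.trans (map_zero _).symm))
  have hcomm (x y : centralizerOrder T u) : x * y = y * x := by
    apply ψ.injective
    rw [map_mul, map_mul]
    exact Subtype.ext (hv.commute (mem_centralizerOrder.1 (ψ x).2).1
      (mem_centralizerOrder.1 (ψ y).2).1)
  have hwu := (mem_centralizerOrder.1 w.2).1
  refine hw.of_commute_iff fun x => ⟨fun hx => ?_, fun hx => hw.commute hx hwu.symm⟩
  obtain ⟨r, hr, hrx⟩ := hb.exists_smul_mem x
  have h : (r • x) * w.1 = w.1 * (r • x) := congrArg Subtype.val (hcomm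
    ⟨r • x, mem_centralizerOrder.2 ⟨by rw [smul_mul_assoc, mul_smul_comm, hx], hrx⟩⟩ w)
  rw [smul_mul_assoc, mul_smul_comm] at h
  exact smul_right_injective _ hr h

end Basis

end Order

lemma commute_one_add_smul_iff {k A : Type*} [Field k] [Ring A] [Algebra k A] {t : k} (ht : t ≠ 0)
    {x y : A} : x * (1 + t • y) = (1 + t • y) * x ↔ x * y = y * x := by
  rw [mul_add, add_mul, mul_one, one_mul, mul_smul_comm, smul_mul_assoc, add_right_inj]
  exact (smul_right_injective _ ht).eq_iff

/-! ### Elements near the identity and near a point with simple spectrum -/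

section Topology

open MatPoly Filter

variable {ℓ : ℕ} [Fact ℓ.Prime] {V : Type*} [AddCommGroup V] [Module ℚ_[ℓ] V]
  {n : Type*} [Fintype n] (b : Module.Basis n ℚ_[ℓ] V)

/-- The identification of a normed algebra with `End(V)` that comes from a basis of `V`. -/
def endEquiv : ((n → ℚ_[ℓ]) →L[ℚ_[ℓ]] (n → ℚ_[ℓ])) ≃ₐ[ℚ_[ℓ]] Module.End ℚ_[ℓ] V :=
  (Module.End.toContinuousLinearMap (n → ℚ_[ℓ])).symm.trans (b.equivFun.symm.conjAlgEquiv ℚ_[ℓ])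

lemma continuous_endEquiv_symm : Continuous (endEquiv b).symm :=
  IsModuleTopology.continuous_of_linearMap (endEquiv b).symm.toLinearMap

lemma continuous_endEquiv : Continuous (endEquiv b) := by
  have : IsTopologicalAddGroup (Module.End ℚ_[ℓ] V) :=
    IsModuleTopology.topologicalAddGroup ℚ_[ℓ] _
  exact (endEquiv b).toLinearMap.continuous_of_finiteDimensional

/-- A neighbourhood of the identity in `Aut(V)` contains all automorphisms in some neighbourhood of
the identity in `End(V)`. -/
lemma exists_nhds_endEquiv {S : Set (LinearMap.GeneralLinearGroup ℚ_[ℓ] V)} (hS : S ∈ 𝓝 1) :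
    ∃ N ∈ 𝓝 (1 : (n → ℚ_[ℓ]) →L[ℚ_[ℓ]] (n → ℚ_[ℓ])), ∀ a ∈ N, ∃ g ∈ S, g.val = endEquiv b a := by
  let F := Units.map (endEquiv b).toMulEquiv.toMonoidHom
  have hF : Continuous F := Continuous.units_map _ (continuous_endEquiv b)
  have h1 : F ⁻¹' S ∈ 𝓝 1 := hF.continuousAt.preimage_mem_nhds (by rwa [map_one])
  refine ⟨Units.val '' (F ⁻¹' S), Units.isOpenEmbedding_val.isOpenMap.image_mem_nhds h1, ?_⟩
  rintro _ ⟨g, hg, rfl⟩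
  exact ⟨F g, hg, rfl⟩

variable {b}

lemma endEquiv_commute_iff {x y : (n → ℚ_[ℓ]) →L[ℚ_[ℓ]] (n → ℚ_[ℓ])} :
    endEquiv b x * endEquiv b y = endEquiv b y * endEquiv b x ↔ x * y = y * x := by
  rw [← map_mul, ← map_mul, EmbeddingLike.apply_eq_iff_eq]

variable [DecidableEq n]

lemma LinearMap.HasSimpleSpectrum.endEquiv_symm {u : Module.End ℚ_[ℓ] V}
    (hu : HasSimpleSpectrum b u) (x : (n → ℚ_[ℓ]) →L[ℚ_[ℓ]] (n → ℚ_[ℓ])) :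
    (x * (endEquiv b).symm u - (endEquiv b).symm u * x) * (endEquiv b).symm u =
      (endEquiv b).symm u * (x * (endEquiv b).symm u - (endEquiv b).symm u * x) →
    x * (endEquiv b).symm u = (endEquiv b).symm u * x := by
  intro h
  apply (endEquiv b).injective
  have := congrArg (endEquiv b) h
  simp only [map_mul, map_sub, AlgEquiv.apply_symm_apply] at this ⊢
  exact hu.commute_of_commutator _ this

/-- Every neighbourhood of the identity in the group of rational points of a connected algebraic
group contains elements with the same centralizer as a given element with simple spectrum. -/
lemma LinearAlgebraicSubgroup.exists_mem_nhds_centralizer_eq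
    {GG : LinearAlgebraicSubgroup ℚ_[ℓ] V} (hconn : GG.IsConnectedGroup)
    {u : LinearMap.GeneralLinearGroup ℚ_[ℓ] V} (hu : u ∈ GG.rationalPoints)
    (hs : LinearMap.HasSimpleSpectrum b u.val)
    {S : Set (LinearMap.GeneralLinearGroup ℚ_[ℓ] V)} (hS : S ∈ 𝓝 1) :
    ∃ g ∈ S, g ∈ GG.rationalPoints ∧
      ∀ x : Module.End ℚ_[ℓ] V, x * g.val = g.val * x ↔ x * u.val = u.val * x := by
  let φ := (endEquiv b).trans (LinearMap.toMatrixAlgEquiv b)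
  obtain ⟨P, μ, hμ, hP⟩ := id hs
  have hΓ := isConnectedGroup_matrixGroup b GG hconn
  let M := Units.map (LinearMap.toMatrixAlgEquiv b).toMulEquiv.toMonoidHom u
  obtain ⟨c, hc, hcu, hinj⟩ := exists_rational_diagCoord_injective hΓ
    (fun σ _ hg => map_mem_matrixGroup b GG σ hg) (u := M)
    ((mem_rationalPoints_iff b GG u).1 hu) hμ hP
  obtain ⟨c, rfl⟩ := φ.surjective c
  have hcs : LinearMap.HasSimpleSpectrum b (endEquiv b c) :=
    ⟨P, _, hinj, mul_eq_of_commute hμ hP (map_commute_iff.2 hcu)⟩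
  have hcu' : endEquiv b c * u.val = u.val * endEquiv b c :=
    LinearMap.toMatrixAlgEquiv_commute_iff.1 hcu
  have hca := hcs.endEquiv_symm
  simp only [AlgEquiv.symm_apply_apply] at hca
  obtain ⟨N, hN, hNS⟩ := exists_nhds_endEquiv b hS
  -- The point is `g = 1 + t y = exp(tc)`. Since `y` is near `c` and commutes with it, `Z(g) = Z(y)
  -- = Z(c) = Z(u)`.
  obtain ⟨t, ht, y, hy, hyc, hyN, hzero⟩ := exists_mem_zeroLocus φ
    (I := rationalVanishingIdeal ℚ_[ℓ] (matrixGroup b GG))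
    (fun p hp m => ev_wordDer_replicate_eq_zero hΓ hc hp m) hN (eventually_centralizer_le ℚ_[ℓ] hca)
  obtain ⟨g, hg, hgy⟩ := hNS _ hyN
  refine ⟨g, hg, mem_rationalPoints_of_forall b GG g fun p hp => ?_, fun x => ?_⟩
  · rw [hgy]
    exact hzero p hp
  · have hcy (z) (hz : z * c = c * z) : z * y = y * z :=
      endEquiv_commute_iff.1 (hcs.commute (endEquiv_commute_iff.2 hz) (endEquiv_commute_iff.2 hyc))
    rw [hgy, ← hcs.commute_iff hs hcu']
    obtain ⟨x, rfl⟩ := (endEquiv b).surjective x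
    rw [endEquiv_commute_iff, endEquiv_commute_iff]
    refine (commute_one_add_smul_iff ht).trans ⟨hy hyc hcy x, hcy x⟩

variable [Module ℤ_[ℓ] V] [IsScalarTower ℤ_[ℓ] ℚ_[ℓ] V] {T : Submodule ℤ_[ℓ] V}

/-- The isomorphism class of the order is locally constant at elements with simple spectrum. -/
lemma IsLatticeBasis.eventually_nonempty_equiv (hb : IsLatticeBasis T b) {u : Module.End ℚ_[ℓ] V}
    (hu : LinearMap.HasSimpleSpectrum b u) :
    ∀ᶠ v in 𝓝 u, Nonempty (centralizerOrder T v ≃ₐ[ℤ_[ℓ]] centralizerOrder T u) := by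
  obtain ⟨a, rfl⟩ := (endEquiv b).surjective u
  have ha := hu.endEquiv_symm
  simp only [AlgEquiv.symm_apply_apply] at ha
  have hW : endEquiv b ⁻¹' (endLattice T : Set (Module.End ℚ_[ℓ] V)) ∈ 𝓝 1 :=
    (hb.isOpen_endLattice.preimage (continuous_endEquiv b)).mem_nhds (by
      rw [Set.mem_preimage, map_one]
      exact one_mem (endLattice T))
  -- The neighbourhood of 1 is `End(T)`, so that `g` and `g⁻¹` both preserve the lattice.
  have h := eventually_exists_conj ℚ_[ℓ] ha hW (eventually_centralizer_le ℚ_[ℓ] ha)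
  have hc := (continuous_endEquiv_symm b).tendsto (endEquiv b a)
  rw [AlgEquiv.symm_apply_apply] at hc
  filter_upwards [hc.eventually h] with v hv
  obtain ⟨g, hg, hg', t, ht, hta, hv⟩ := hv
  have hv' : v = endEquiv b g.val * endEquiv b t * endEquiv b (g⁻¹).val := by
    rw [← map_mul, ← map_mul, ← hv, AlgEquiv.apply_symm_apply]
  have hat (z) (hz : z * a = a * z) : z * t = t * z :=
    endEquiv_commute_iff.1 (hu.commute (endEquiv_commute_iff.2 hz) (endEquiv_commute_iff.2 hta))
  have hZ : centralizerOrder T (endEquiv b t) = centralizerOrder T (endEquiv b a) := by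
    refine centralizerOrder_congr fun x => ?_
    obtain ⟨x, rfl⟩ := (endEquiv b).surjective x
    rw [endEquiv_commute_iff, endEquiv_commute_iff]
    exact ⟨ht hta hat x, hat x⟩
  rw [← hZ, hv']
  refine nonempty_centralizerOrder_conj ?_ ?_ hg hg' _
  · rw [← map_mul, Units.mul_inv, map_one]
  · rw [← map_mul, Units.inv_mul, map_one]

end Topology

end

/-! ### The theorem -/

theorem mainTheorem7 {ℓ : ℕ} [Fact ℓ.Prime]
    {V : Type*} [AddCommGroup V] [Module ℚ_[ℓ] V] [FiniteDimensional ℚ_[ℓ] V] [Nontrivial V]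
    [Module ℤ_[ℓ] V] [IsScalarTower ℤ_[ℓ] ℚ_[ℓ] V]
    (T : Submodule ℤ_[ℓ] V) [Submodule.IsLattice ℚ_[ℓ] T]
    (GG : LinearAlgebraicSubgroup ℚ_[ℓ] V) (hconn : GG.IsConnectedGroup) (hred : GG.IsReductive)
    (G : Subgroup GG.rationalPoints)
    (hopen : IsOpen (G : Set GG.rationalPoints)) (hcompact : IsCompact (G : Set GG.rationalPoints))
    (hT : ∀ g ∈ G, ∀ x : V,
      (g : LinearMap.GeneralLinearGroup ℚ_[ℓ] V).val x ∈ T ↔ x ∈ T)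
    (ub : GG.rationalPoints)
    (hub : ((LinearMap.charpoly (ub : LinearMap.GeneralLinearGroup ℚ_[ℓ] V).val).aroots
      (AlgebraicClosure ℚ_[ℓ])).Nodup) :
    (orderLocus T G ub).Nonempty ∧
    IsOpen (orderLocus T G ub) ∧
    (∀ g : G, ∀ u ∈ orderLocus T G ub, g * u * g⁻¹ ∈ orderLocus T G ub) ∧
    (∀ u ∈ frontier (orderLocus T G ub),
      charDiscr ((u : GG.rationalPoints) : LinearMap.GeneralLinearGroup ℚ_[ℓ] V).val = 0) ∧
    (2 ≤ Module.finrank ℚ_[ℓ] V → (1 : G) ∈ frontier (orderLocus T G ub)) := by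
  classical
  obtain ⟨b, hb⟩ := exists_isLatticeBasis (T := T)
  let j : G → Module.End ℚ_[ℓ] V := fun g => g.1.1.val
  have hj : Continuous j :=
    Units.continuous_val.comp (continuous_subtype_val.comp continuous_subtype_val)
  have hs : LinearMap.HasSimpleSpectrum b ub.1.val := LinearMap.hasSimpleSpectrum_of_nodup hub
  have hnear {u : G} (hu : LinearMap.HasSimpleSpectrum b (j u)) :
      ∀ᶠ v in 𝓝 u, Nonempty (centralizerOrder T (j v) ≃ₐ[ℤ_[ℓ]] centralizerOrder T (j u)) :=
    (hj.tendsto u).eventually (hb.eventually_nonempty_equiv hu)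
  have hX : IsOpen (orderLocus T G ub) := by
    refine isOpen_iff_mem_nhds.2 fun u hu => ?_
    filter_upwards [hnear (hb.hasSimpleSpectrum_of_equiv hs hu.some)] with v hv
    exact ⟨hv.some.trans hu.some⟩
  have hone : (1 : G) ∈ closure (orderLocus T G ub) := by
    refine mem_closure_iff_nhds.2 fun O hO => ?_
    -- As `G` is open, a rational point close enough to 1 lies in `O`, in particular in `G`.
    have h1 : Subtype.val '' O ∈ 𝓝 (1 : GG.rationalPoints) :=
      hopen.isOpenMap_subtype_val.image_mem_nhds hO
    obtain ⟨S, hS, hSO⟩ := mem_nhds_subtype _ _ _ |>.1 h1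
    obtain ⟨g, hg, hgG, hZ⟩ :=
      LinearAlgebraicSubgroup.exists_mem_nhds_centralizer_eq hconn ub.2 hs hS
    obtain ⟨u, huO, hu⟩ := hSO (show (⟨g, hgG⟩ : GG.rationalPoints) ∈ Subtype.val ⁻¹' S from hg)
    refine ⟨u, huO, ?_⟩
    have h2 : j u = g.val := by
      change u.1.1.val = g.val
      rw [hu]
    have h3 : centralizerOrder T (j u) = centralizerOrder T ub.1.val := by
      rw [h2]
      exact centralizerOrder_congr hZ
    exact ⟨Subalgebra.equivOfEq _ _ h3⟩
  refine ⟨closure_nonempty_iff.1 ⟨1, hone⟩, hX, fun g u hu => ?_, fun u hu => ?_, fun hd => ?_⟩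
  · obtain ⟨ψ⟩ := hu
    obtain ⟨ψ'⟩ := nonempty_centralizerOrder_conj (T := T) (g := j g) (g' := j g⁻¹)
      g.1.1.mul_inv g.1.1.inv_mul (fun x hx => (hT g.1 g.2 x).2 hx)
      (fun x hx => (hT _ (g⁻¹).2 x).2 hx) (j u)
    exact ⟨ψ'.trans ψ⟩
  · by_contra h
    have hsu : LinearMap.HasSimpleSpectrum b (j u) :=
      LinearMap.hasSimpleSpectrum_of_discr_ne_zero h
    rw [hX.frontier_eq] at hu
    -- Near `u` the order has constant isomorphism class, and some nearby `v` is in the locus; so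
    -- `u` is in it, hence not on the boundary of this open set.
    obtain ⟨v, hv, hvX⟩ := mem_closure_iff_nhds.1 hu.1 _ (hnear hsu)
    exact hu.2 ⟨hv.some.symm.trans hvX.some⟩
  · rw [hX.frontier_eq]
    refine ⟨hone, fun ⟨ψ⟩ => ?_⟩
    have : Nontrivial (Module.Free.ChooseBasisIndex ℤ_[ℓ] T) := by
      rw [← Fintype.one_lt_card_iff_nontrivial, ← Module.finrank_eq_card_basis b]
      exact hd
    obtain ⟨f, hf, g, hg, hfg⟩ := hb.not_commute
    -- The order of the identity is all of `End(T)`.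
    have hmem {x : Module.End ℚ_[ℓ] V} (hx : x ∈ endLattice T) :
        x ∈ centralizerOrder T ((1 : G) : GG.rationalPoints).1.val :=
      mem_centralizerOrder.2 ⟨(mul_one x).trans (one_mul x).symm, hx⟩
    refine hfg (congrArg Subtype.val (ψ.injective (a₁ := ⟨f, hmem hf⟩ * ⟨g, hmem hg⟩)
      (a₂ := ⟨g, hmem hg⟩ * ⟨f, hmem hf⟩) ?_))
    rw [map_mul, map_mul]
    exact Subtype.ext (hs.commute (mem_centralizerOrder.1 (ψ _).2).1
      (mem_centralizerOrder.1 (ψ _).2).1)
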